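/- Conventions. A net is a family indexed by $\varepsilon\in(0,1)$; a net $(a_\varepsilon)$ in $[0,\infty]$ is negligible if $a_\varepsilon=O(\varepsilon^m)$ as $\varepsilon\to0$ for every $m$, and moderate if this holds for some $m\in\mathbb R$. $\widetilde{\mathbb C}$ is the group of moderate nets of complex numbers modulo nets $(z_\varepsilon)$ with $(|z_\varepsilon|)$ negligible. For a smooth manifold $X$, $\mathcal G(X)=\mathcal E_M(X)/\mathcal N(X)$, where $\mathcal E_M(X)$ consists of the nets $(u_\varepsilon)$ of smooth functions $X\to\mathbb C$ such that for all compact $K\subseteq X$ and $k\in\mathbb N$ there is $b\in\mathbb R$ with $\sup_{K}|L_{\xi_1}\cdots L_{\xi_k}u_\varepsilon|=O(\varepsilon^b)$ for all smooth vector fields $\xi_1,\dots,\xi_k$ on $X$, and $\mathcal N(X)$ consists of those for which $\sup_K|u_\varepsilon|$ is negligible for every compact $K\subseteq X$. $\widetilde X_c$ is the set of nets $(p_\varepsilon)$ in $X$ that lie in a fixed compact subset of $X$ for all small $\varepsilon$, modulo the relation that the net of Riemannian distances of $p_\varepsilon$ and $q_\varepsilon$ is negligible. For $u\in\mathcal G(X)$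 and $p\in\widetilde X_c$, the point value $u(p)\in\widetilde{\mathbb C}$ is the class of $(u_\varepsilon(p_\varepsilon))_\varepsilon$. For a submanifold $Y\subseteq\mathbb R^{d}$, $\widetilde Y_c$ is regarded as a subset of $\widetilde{\mathbb C}^{d}$ through the map that is the identity on representatives. **Proposition.** Let $X\subseteq\mathbb R^{d_1}$ and $Y\subseteq\mathbb R^{d_2}$ be (embedded) smooth submanifolds and let $u\in\mathcal G(X)^{d_2}$. The following are equivalent: 1. $u$ is c-bounded into $Y$, i.e. $u$ has a representative $(u_\varepsilon)_\varepsilon$ such that for each compact $K\subseteq X$ there are a compact $K'\subseteq Y$ and $\varepsilon_0>0$ with $u_\varepsilon(K)\subseteq K'$ for all $\varepsilon\le\varepsilon_0$; 2. for some representative $(u_\varepsilon)_\varepsilon$ of $u$: for each compact $K\subseteq X$ there is a compact $K'\subseteq Y$ such that $\sup_{x\in K}d(u_\varepsilon(x),K')=O(\varepsilon^m)$ as $\varepsilon\to0$ for every $m\in\mathbb N$; 2'. the property in 2 holds for every representative $(u_\varepsilon)_\varepsilon$ of $u$; 3. $u(p)\in\widetilde Y_c$ for every $p\in\widetilde X_c$.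 Here $\mathbb R^{d_2}\subseteq\mathbb C^{d_2}$, $d$ is the Euclidean distance, and $d(z,\emptyset)=\infty$. -/

import Mathlib

open Set Filter Topology Manifold
open scoped ContDiff ENNReal NNReal

noncomputable section

namespace Colombeau

set_option linter.unusedSectionVars false

/-! ### Asymptotics of nets -/

/-- The index set `(0,1)` of all nets. -/
abbrev Eps : Type := Ioo (0 : ℝ) 1

/-- `a ε = O(ε ^ b)` as `ε → 0`, for a net `a` of numbers in `[0,∞]`. -/
def IsBigOPow (a : Eps → ℝ≥0∞) (b : ℝ) : Prop :=
  ∃ C : ℝ≥0, ∃ ε₀ > (0 : ℝ), ∀ ε : Eps, (ε : ℝ) < ε₀ → a ε ≤ C * ENNReal.ofReal ((ε : ℝ) ^ b)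

lemma IsBigOPow.mono {a a' : Eps → ℝ≥0∞} {b : ℝ} (h : IsBigOPow a b)
    (hle : ∃ ε₀ > (0 : ℝ), ∀ ε : Eps, (ε : ℝ) < ε₀ → a' ε ≤ a ε) : IsBigOPow a' b := by
  obtain ⟨C, e, he, h⟩ := h
  obtain ⟨e', he', h'⟩ := hle
  exact ⟨C, min e e', lt_min he he', fun ε hε ↦
    (h' ε (hε.trans_le (min_le_right _ _))).trans (h ε (hε.trans_le (min_le_left _ _)))⟩

lemma IsBigOPow.mono_le {a a' : Eps → ℝ≥0∞} {b : ℝ} (h : IsBigOPow a b)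
    (hle : ∀ ε, a' ε ≤ a ε) : IsBigOPow a' b :=
  h.mono ⟨1, one_pos, fun ε _ ↦ hle ε⟩

lemma IsBigOPow.weaken {a : Eps → ℝ≥0∞} {b b' : ℝ} (h : IsBigOPow a b) (hb : b' ≤ b) :
    IsBigOPow a b' := by
  obtain ⟨C, e, he, h⟩ := h
  refine ⟨C, e, he, fun ε hε ↦ (h ε hε).trans ?_⟩
  refine mul_le_mul' le_rfl (ENNReal.ofReal_le_ofReal ?_)
  exact Real.rpow_le_rpow_of_exponent_ge ε.2.1 ε.2.2.le hb

lemma IsBigOPow.zero (b : ℝ) : IsBigOPow (fun _ ↦ 0) b :=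
  ⟨0, 1, one_pos, fun _ _ ↦ by simp⟩

lemma IsBigOPow.add {a a' : Eps → ℝ≥0∞} {b : ℝ} (h : IsBigOPow a b) (h' : IsBigOPow a' b) :
    IsBigOPow (fun ε ↦ a ε + a' ε) b := by
  obtain ⟨C, e, he, h⟩ := h
  obtain ⟨C', e', he', h'⟩ := h'
  refine ⟨C + C', min e e', lt_min he he', fun ε hε ↦ ?_⟩
  refine (add_le_add (h ε (hε.trans_le (min_le_left _ _)))
    (h' ε (hε.trans_le (min_le_right _ _)))).trans_eq ?_
  push_cast
  ring

lemma IsBigOPow.mul {a a' : Eps → ℝ≥0∞} {b b' : ℝ} (h : IsBigOPow a b) (h' : IsBigOPow a' b') :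
    IsBigOPow (fun ε ↦ a ε * a' ε) (b + b') := by
  obtain ⟨C, e, he, h⟩ := h
  obtain ⟨C', e', he', h'⟩ := h'
  refine ⟨C * C', min e e', lt_min he he', fun ε hε ↦ ?_⟩
  refine (mul_le_mul' (h ε (hε.trans_le (min_le_left _ _)))
    (h' ε (hε.trans_le (min_le_right _ _)))).trans_eq ?_
  rw [Real.rpow_add ε.2.1, ENNReal.ofReal_mul (Real.rpow_nonneg ε.2.1.le _)]
  push_cast
  ring

/-- `a ε = O(ε ^ b)` for some real `b`. -/
def IsModerate (a : Eps → ℝ≥0∞) : Prop := ∃ b : ℝ, IsBigOPow a b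

/-- `a ε = O(ε ^ b)` for all real `b`. -/
def IsNegligible (a : Eps → ℝ≥0∞) : Prop := ∀ b : ℝ, IsBigOPow a b

lemma IsModerate.add {a a' : Eps → ℝ≥0∞} (h : IsModerate a) (h' : IsModerate a') :
    IsModerate (fun ε ↦ a ε + a' ε) := by
  obtain ⟨b, h⟩ := h
  obtain ⟨b', h'⟩ := h'
  exact ⟨min b b', (h.weaken (min_le_left _ _)).add (h'.weaken (min_le_right _ _))⟩

lemma IsNegligible.add {a a' : Eps → ℝ≥0∞} (h : IsNegligible a) (h' : IsNegligible a') :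
    IsNegligible (fun ε ↦ a ε + a' ε) := fun b ↦ (h b).add (h' b)

/-! ### Generalized numbers -/

/-- The moderate nets of complex numbers. -/
def moderateNumbers : AddSubgroup (Eps → ℂ) where
  carrier := {z | IsModerate fun ε ↦ ‖z ε‖ₑ}
  zero_mem' := ⟨0, by simpa using IsBigOPow.zero 0⟩
  add_mem' {z w} hz hw := by
    obtain ⟨b, h⟩ := IsModerate.add hz hw
    exact ⟨b, h.mono_le fun ε ↦ enorm_add_le _ _⟩
  neg_mem' {z} hz := by simpa using hz

/-- The negligible nets of complex numbers. -/
def negligibleNumbers : AddSubgroup moderateNumbers where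
  carrier := {z | IsNegligible fun ε ↦ ‖z.1 ε‖ₑ}
  zero_mem' b := by simpa using IsBigOPow.zero b
  add_mem' {z w} hz hw b := (IsNegligible.add hz hw b).mono_le fun ε ↦ enorm_add_le _ _
  neg_mem' {z} hz := by simpa using hz

/-- The Colombeau generalized complex numbers. -/
abbrev GenNumber : Type := moderateNumbers ⧸ negligibleNumbers

section Manifold

variable {d : ℕ} (n : ℕ) (X : Set (EuclideanSpace ℝ (Fin d)))
  [ChartedSpace (EuclideanSpace ℝ (Fin n)) X]

/-- `X ⊆ ℝ^d`, with its given `n`-dimensional smooth structure, is an embedded smooth submanifold: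
the inclusion is a smooth embedding (this determines the smooth structure). -/
abbrev IsEmbeddedSubmanifold : Prop :=
  IsSmoothEmbedding (𝓡 n) (𝓡 d) ∞ (Subtype.val : X → EuclideanSpace ℝ (Fin d))

/-- The smooth functions `X → ℂ`. -/
abbrev SmoothFun : Type := C^∞⟮𝓡 n, X; 𝓘(ℝ, ℂ), ℂ⟯

variable [IsManifold (𝓡 n) ∞ X]

/-- The smooth vector fields on `X`. -/
abbrev VectorField : Type :=
  Cₛ^∞⟮𝓡 n; EuclideanSpace ℝ (Fin n), fun x : X ↦ TangentSpace (𝓡 n) x⟯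

variable {n X}

/-! ### The algebra of generalized functions -/

/-- The Lie derivative of a smooth function along a smooth vector field. -/
def lieDeriv (ξ : VectorField n X) (f : SmoothFun n X) : SmoothFun n X where
  val x := mfderiv (𝓡 n) 𝓘(ℝ, ℂ) f x (ξ x)
  property := by
    have h1 : ContMDiff (𝓡 n).tangent 𝓘(ℝ, ℂ).tangent ∞ (tangentMap (𝓡 n) 𝓘(ℝ, ℂ) f) :=
      f.contMDiff.contMDiff_tangentMap (by simp)
    exact (contMDiff_snd_tangentBundle_modelSpace ℂ 𝓘(ℝ, ℂ)).comp (h1.comp ξ.contMDiff)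

lemma lieDeriv_add (ξ : VectorField n X) (f g : SmoothFun n X) :
    lieDeriv ξ (f + g) = lieDeriv ξ f + lieDeriv ξ g := by
  ext x
  change mfderiv (𝓡 n) 𝓘(ℝ, ℂ) (⇑f + ⇑g) x (ξ x) = _
  rw [mfderiv_add f.mdifferentiableAt g.mdifferentiableAt]
  rfl

lemma lieDeriv_neg (ξ : VectorField n X) (f : SmoothFun n X) :
    lieDeriv ξ (-f) = -lieDeriv ξ f := by
  have h0 : lieDeriv ξ (0 : SmoothFun n X) = 0 := by
    have := lieDeriv_add ξ 0 0
    simpa using this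
  have := lieDeriv_add ξ f (-f)
  rw [add_neg_cancel, h0] at this
  exact (neg_eq_of_add_eq_zero_right this.symm).symm

/-- The iterated Lie derivative `L_{ξ₁} ⋯ L_{ξₖ} f` along a list `[ξ₁, …, ξₖ]`. -/
def iterLieDeriv (ξs : List (VectorField n X)) (f : SmoothFun n X) : SmoothFun n X :=
  ξs.foldr lieDeriv f

lemma iterLieDeriv_add (ξs : List (VectorField n X)) (f g : SmoothFun n X) :
    iterLieDeriv ξs (f + g) = iterLieDeriv ξs f + iterLieDeriv ξs g := by
  induction ξs with
  | nil => rfl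
  | cons ξ ξs ih =>
    change lieDeriv ξ (iterLieDeriv ξs (f + g)) = _
    rw [ih, lieDeriv_add]
    rfl

lemma iterLieDeriv_neg (ξs : List (VectorField n X)) (f : SmoothFun n X) :
    iterLieDeriv ξs (-f) = -iterLieDeriv ξs f := by
  induction ξs with
  | nil => rfl
  | cons ξ ξs ih =>
    change lieDeriv ξ (iterLieDeriv ξs (-f)) = _
    rw [ih, lieDeriv_neg]
    rfl

lemma iterLieDeriv_zero (ξs : List (VectorField n X)) :
    iterLieDeriv ξs (0 : SmoothFun n X) = 0 := by
  have := iterLieDeriv_add ξs 0 0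
  simpa using this

/-- `sup_{p ∈ K} |f p|`, in `[0,∞]`. -/
def supOn (K : Set X) (f : X → ℂ) : ℝ≥0∞ := ⨆ p ∈ K, ‖f p‖ₑ

lemma le_supOn {K : Set X} (f : X → ℂ) {p : X} (hp : p ∈ K) : ‖f p‖ₑ ≤ supOn K f :=
  le_iSup₂ (f := fun p (_ : p ∈ K) ↦ ‖f p‖ₑ) p hp

lemma supOn_add_le (K : Set X) (f g : X → ℂ) : supOn K (f + g) ≤ supOn K f + supOn K g :=
  iSup₂_le fun _ hp ↦ (enorm_add_le _ _).trans (add_le_add (le_supOn f hp) (le_supOn g hp))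

lemma supOn_neg (K : Set X) (f : X → ℂ) : supOn K (-f) = supOn K f := by
  simp [supOn]

lemma supOn_zero (K : Set X) : supOn K 0 = 0 := by
  simp [supOn]

variable (n X)

/-- The moderate nets of smooth functions on `X`. -/
def moderateNets : AddSubgroup (Eps → SmoothFun n X) where
  carrier := {u | ∀ K : Set X, IsCompact K → ∀ k : ℕ, ∃ b : ℝ,
    ∀ ξs : List (VectorField n X), ξs.length = k →
      IsBigOPow (fun ε ↦ supOn K (iterLieDeriv ξs (u ε))) b}
  zero_mem' K _ k := by
    refine ⟨0, fun ξs _ ↦ (IsBigOPow.zero 0).mono_le fun ε ↦ ?_⟩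
    simp only [Pi.zero_apply, iterLieDeriv_zero]
    exact (supOn_zero K).le
  add_mem' hu hv K hK k := by
    obtain ⟨b, h⟩ := hu K hK k
    obtain ⟨b', h'⟩ := hv K hK k
    refine ⟨min b b', fun ξs hξ ↦ (((h ξs hξ).weaken (min_le_left _ _)).add
      ((h' ξs hξ).weaken (min_le_right _ _))).mono_le fun ε ↦ ?_⟩
    simp only [Pi.add_apply, iterLieDeriv_add]
    exact supOn_add_le K _ _
  neg_mem' hu K hK k := by
    obtain ⟨b, h⟩ := hu K hK k
    refine ⟨b, fun ξs hξ ↦ (h ξs hξ).mono_le fun ε ↦ ?_⟩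
    simp only [Pi.neg_apply, iterLieDeriv_neg]
    exact (supOn_neg K _).le

/-- The negligible nets of smooth functions on `X`. -/
def negligibleNets : AddSubgroup (moderateNets n X) where
  carrier := {u | ∀ K : Set X, IsCompact K → IsNegligible fun ε ↦ supOn K (u.1 ε)}
  zero_mem' K _ b := (IsBigOPow.zero b).mono_le fun _ ↦ (supOn_zero K).le
  add_mem' hu hv K hK b :=
    ((hu K hK b).add (hv K hK b)).mono_le fun _ ↦ supOn_add_le K _ _
  neg_mem' hu K hK b := (hu K hK b).mono_le fun _ ↦ (supOn_neg K _).le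

/-- The space `𝒢(X)` of (special) Colombeau generalized functions on `X`. -/
abbrev GenFun : Type := moderateNets n X ⧸ negligibleNets n X

variable {n X}

/-! ### The Riemannian distance and compactly supported generalized points -/

/-- The norm on the tangent spaces of `X` given by the Riemannian metric that is induced by the
Euclidean metric of `ℝ^d`. -/
@[reducible]
def inducedENorm (x : X) : ENorm (TangentSpace (𝓡 n) x) where
  enorm v :=
    let w : EuclideanSpace ℝ (Fin d) :=
      mfderiv (𝓡 n) (𝓡 d) (Subtype.val : X → EuclideanSpace ℝ (Fin d)) x v
    ‖w‖ₑ

variable (n) in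
/-- The Riemannian distance on `X` for the induced metric (the infimum of the lengths of
`C^1` paths in `X`); it is `∞` between different components. -/
def riemDist (p q : X) : ℝ≥0∞ :=
  letI : ∀ x : X, ENorm (TangentSpace (𝓡 n) x) := fun x ↦ inducedENorm x
  riemannianEDist (𝓡 n) p q

lemma enormSMulClass_inducedENorm (x : X) :
    letI : ENorm (TangentSpace (𝓡 n) x) := inducedENorm x
    ENormSMulClass ℝ (TangentSpace (𝓡 n) x) := by
  let _ : ENorm (TangentSpace (𝓡 n) x) := inducedENorm x
  refine ⟨fun r v ↦ ?_⟩
  change ‖(show EuclideanSpace ℝ (Fin d) from mfderiv (𝓡 n) (𝓡 d) (Subtype.val : X → EuclideanSpace ℝ (Fin d)) x (r • v))‖ₑ = _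
  rw [map_smul]
  exact enorm_smul r (show EuclideanSpace ℝ (Fin d) from _)

lemma riemDist_self (p : X) : riemDist n p p = 0 := by
  let _ : ∀ x : X, ENorm (TangentSpace (𝓡 n) x) := fun x ↦ inducedENorm x
  have : ∀ x : X, ENormSMulClass ℝ (TangentSpace (𝓡 n) x) := enormSMulClass_inducedENorm
  exact riemannianEDist_self

lemma riemDist_comm (p q : X) : riemDist n p q = riemDist n q p := by
  let _ : ∀ x : X, ENorm (TangentSpace (𝓡 n) x) := fun x ↦ inducedENorm x
  have : ∀ x : X, ENormSMulClass ℝ (TangentSpace (𝓡 n) x) := enormSMulClass_inducedENorm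
  exact riemannianEDist_comm

lemma riemDist_triangle (p q r : X) : riemDist n p r ≤ riemDist n p q + riemDist n q r := by
  let _ : ∀ x : X, ENorm (TangentSpace (𝓡 n) x) := fun x ↦ inducedENorm x
  have : ∀ x : X, ENormSMulClass ℝ (TangentSpace (𝓡 n) x) := enormSMulClass_inducedENorm
  exact riemannianEDist_triangle

lemma edist_le_riemDist
    (hX : IsEmbeddedSubmanifold n X)
    (p q : X) : edist (p : EuclideanSpace ℝ (Fin d)) q ≤ riemDist n p q := by
  let _ : ∀ x : X, ENorm (TangentSpace (𝓡 n) x) := fun x ↦ inducedENorm x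
  have : ∀ x : X, ENormSMulClass ℝ (TangentSpace (𝓡 n) x) := enormSMulClass_inducedENorm
  refine le_of_forall_gt fun r hr ↦ ?_
  obtain ⟨γ, h0, h1, hγ, hl⟩ := exists_lt_of_riemannianEDist_lt hr
  refine lt_of_le_of_lt ?_ hl
  have D : ContDiffOn ℝ 1 (fun t ↦ (γ t : EuclideanSpace ℝ (Fin d))) (Icc 0 1) :=
    contMDiffOn_iff_contDiffOn.mp ((hX.contMDiff.of_le (by simp)).comp_contMDiffOn hγ)
  rw [pathELength_eq_lintegral_mfderivWithin_Icc, edist_comm, edist_eq_enorm_sub, ← h0, ← h1]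
  refine (enorm_sub_le_lintegral_derivWithin_Icc_of_contDiffOn_Icc D zero_le_one).trans_eq ?_
  refine MeasureTheory.setLIntegral_congr_fun measurableSet_Icc fun t ht ↦ ?_
  change _ = ‖(show EuclideanSpace ℝ (Fin d) from mfderiv (𝓡 n) (𝓡 d) (Subtype.val : X → EuclideanSpace ℝ (Fin d)) (γ t)
    (mfderivWithin 𝓘(ℝ, ℝ) (𝓡 n) γ (Icc 0 1) t 1))‖ₑ
  have hd : MDifferentiableAt (𝓡 n) (𝓡 d) (Subtype.val : X → EuclideanSpace ℝ (Fin d)) (γ t) :=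
    hX.contMDiff.mdifferentiableAt (by simp)
  have := mfderiv_comp_mfderivWithin t hd (hγ.mdifferentiableOn one_ne_zero t ht)
    (uniqueMDiffWithinAt_iff_uniqueDiffWithinAt.2 (uniqueDiffOn_Icc zero_lt_one t ht))
  rw [← fderivWithin_derivWithin, ← mfderivWithin_eq_fderivWithin]
  congr 1
  exact DFunLike.congr_fun this 1

/-- A net of points of `X` is compactly supported if it eventually lies in a compact subset. -/
def IsCompactlySupported (p : Eps → X) : Prop :=
  ∃ K : Set X, IsCompact K ∧ ∃ ε₀ > (0 : ℝ), ∀ ε : Eps, (ε : ℝ) < ε₀ → p ε ∈ K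

variable (X) in
/-- The compactly supported nets of points of `X`. -/
abbrev CompactNet : Type := {p : Eps → X // IsCompactlySupported p}

variable (n X) in
/-- Two compactly supported nets are equivalent if their Riemannian distance is negligible. -/
def pointSetoid : Setoid (CompactNet X) where
  r p q := IsNegligible fun ε ↦ riemDist n (p.1 ε) (q.1 ε)
  iseqv :=
    { refl _ b := (IsBigOPow.zero b).mono_le fun _ ↦ (riemDist_self _).le
      symm h b := (h b).mono_le fun _ ↦ (riemDist_comm _ _).le
      trans h h' b := ((h b).add (h' b)).mono_le fun _ ↦ riemDist_triangle _ _ _ }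

variable (n X) in
/-- The set `X̃_c` of compactly supported generalized points of `X`. -/
abbrev GenPoint : Type := Quotient (pointSetoid n X)

/-! ### Point values -/

/-- Near every point there are global smooth vector fields that restrict to the coordinate fields of a chart. -/
lemma exists_coordFields (x₀ : X) :
    ∃ ξ : Fin n → VectorField n X, ∀ᶠ x in 𝓝 x₀, ∀ i,
      ξ i x = mfderiv 𝓘(ℝ, EuclideanSpace ℝ (Fin n)) (𝓡 n) (extChartAt (𝓡 n) x₀).symm
        (extChartAt (𝓡 n) x₀ x) (EuclideanSpace.single i (1 : ℝ)) := by
  classical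
  let χ : SmoothBumpFunction (𝓡 n) x₀ := Classical.arbitrary _
  let e := trivializationAt (EuclideanSpace ℝ (Fin n)) (TangentSpace (𝓡 n) : X → Type) x₀
  let b := (EuclideanSpace.basisFun (Fin n) ℝ).toBasis
  let s : Fin n → (x : X) → TangentSpace (𝓡 n) x := fun i x ↦ χ x • e.localFrame b i x
  have hs : ∀ i, ContMDiff (𝓡 n) ((𝓡 n).prod 𝓘(ℝ, EuclideanSpace ℝ (Fin n))) ∞
      (fun x ↦ Bundle.TotalSpace.mk' (EuclideanSpace ℝ (Fin n)) x (s i x)) := by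
    intro i x
    by_cases hx : x ∈ tsupport χ
    · have hx' : x ∈ e.baseSet := by
        have := χ.tsupport_subset_chartAt_source hx
        simpa [e] using this
      exact χ.contMDiffAt.smul_section (contMDiffAt_localFrame_of_mem ∞ e b i hx')
    · have h0 : ContMDiffAt (𝓡 n) ((𝓡 n).prod 𝓘(ℝ, EuclideanSpace ℝ (Fin n))) ∞
        (fun x ↦ Bundle.TotalSpace.mk' (EuclideanSpace ℝ (Fin n)) x (0 : TangentSpace (𝓡 n) x)) x :=
          (Bundle.contMDiff_zeroSection ℝ (TangentSpace (𝓡 n) : X → Type)).contMDiffAt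
      refine h0.congr_of_eventuallyEq ?_
      filter_upwards [(isClosed_tsupport χ).isOpen_compl.mem_nhds hx] with y hy
      have : χ y = 0 := image_eq_zero_of_notMem_tsupport hy
      simp [s, this]
  refine ⟨fun i ↦ ⟨s i, hs i⟩, ?_⟩
  filter_upwards [χ.eventuallyEq_one, (chartAt (EuclideanSpace ℝ (Fin n)) x₀).open_source.mem_nhds
    (mem_chart_source _ x₀)] with x hx hxs i
  have hxb : x ∈ e.baseSet := by simpa [e] using hxs
  have h1 := TangentBundle.symmL_trivializationAt (I := 𝓡 n) hxs
  have h2 : s i x = e.symmL ℝ x (b i) := by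
    have : χ x = 1 := hx
    simp only [s, this, one_smul, e.localFrame_apply_of_mem_baseSet b hxb]
    change e.symm x (b i) = _
    exact (e.symmL_apply (R := ℝ) hxb (b i)).symm
  change s i x = _
  rw [h2, h1]
  rw [ModelWithCorners.range_eq_univ, mfderivWithin_univ]
  simp only [b, OrthonormalBasis.coe_toBasis, EuclideanSpace.basisFun_apply]
  rfl

lemma exists_lipschitz_chart
    (hX : IsEmbeddedSubmanifold n X)
    (x₀ : X) : ∃ C : ℝ≥0, ∃ U ∈ 𝓝 x₀, ∀ a ∈ U, ∀ b ∈ U,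
      edist (extChartAt (𝓡 n) x₀ a) (extChartAt (𝓡 n) x₀ b) ≤
        C * edist (a : EuclideanSpace ℝ (Fin d)) b := by
  obtain ⟨F, _, _, h'⟩ := hX.isImmersion
  have h := h' x₀
  let φ := h.domChart.extend (𝓡 n)
  let ψ := h.codChart.extend (𝓡 d)
  let G : EuclideanSpace ℝ (Fin d) → EuclideanSpace ℝ (Fin n) :=
    fun z ↦ (extChartAt (𝓡 n) x₀) (φ.symm (h.equiv.symm (ψ z)).1)
  have hφψ : ∀ x ∈ h.domChart.source, (h.equiv.symm (ψ x)).1 = φ x := by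
    intro x hx
    have hx1 : x ∈ φ.source := by simpa [φ] using hx
    have := h.writtenInCharts (φ.map_source hx1)
    simp only [Function.comp] at this
    change ψ (φ.symm (φ x)) = _ at this
    rw [φ.left_inv hx1] at this
    rw [this]
    simp
  have hG : ContDiffAt ℝ 1 G x₀ := by
    rw [← contMDiffAt_iff_contDiffAt]
    have h1 : ContMDiffAt (𝓡 d) (𝓡 d) 1 ψ x₀ :=
      (contMDiffAt_of_mem_maximalAtlas (IsManifold.maximalAtlas_subset_of_le (by simp) h.codChart_mem_maximalAtlas)
        h.mem_codChart_source)
    have h2 : ContMDiffAt (𝓡 d) (𝓡 n) 1 (fun z ↦ (h.equiv.symm (ψ z)).1) x₀ := by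
      have : ContMDiff (𝓡 d) (𝓡 n) 1 (fun z ↦ (h.equiv.symm z).1) := by
        rw [contMDiff_iff_contDiff]
        exact contDiff_fst.comp h.equiv.symm.contDiff
      exact this.contMDiffAt.comp (x₀ : EuclideanSpace ℝ (Fin d)) h1
    have e0 := hφψ x₀ h.mem_domChart_source
    have hs : φ x₀ ∈ φ.target := φ.map_source (by simpa [φ] using h.mem_domChart_source)
    have h3 : ContMDiffAt (𝓡 n) (𝓡 n) 1 φ.symm (φ x₀) := by
      have := contMDiffOn_extend_symm (I := 𝓡 n) (n := 1)
        (IsManifold.maximalAtlas_subset_of_le (by simp) h.domChart_mem_maximalAtlas)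
      refine (this _ ?_).contMDiffAt ?_
      · simpa [φ] using h.domChart.map_source h.mem_domChart_source
      · simpa [φ] using h.domChart.open_target.mem_nhds (h.domChart.map_source h.mem_domChart_source)
    have e1 : φ.symm (φ x₀) = x₀ := φ.left_inv (by simpa [φ] using h.mem_domChart_source)
    have h4 : ContMDiffAt (𝓡 n) (𝓡 n) 1 (extChartAt (𝓡 n) x₀) (φ.symm (φ x₀)) := by
      rw [e1]; exact contMDiffAt_extChartAt
    have h5 := h4.comp _ h3
    rw [← e0] at h5
    exact ContMDiffAt.comp (x₀ : EuclideanSpace ℝ (Fin d)) (g := extChartAt (𝓡 n) x₀ ∘ φ.symm)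
      (f := fun z ↦ (h.equiv.symm (ψ z)).1) h5 h2
  obtain ⟨C, t, ht, hC⟩ := hG.exists_lipschitzOnWith
  refine ⟨C, h.domChart.source ∩ Subtype.val ⁻¹' t, inter_mem
    (h.domChart.open_source.mem_nhds h.mem_domChart_source)
    (continuous_subtype_val.continuousAt ht), fun a ha b hb ↦ ?_⟩
  have key : ∀ x ∈ h.domChart.source, G x = extChartAt (𝓡 n) x₀ x := by
    intro x hx
    change (extChartAt (𝓡 n) x₀) (φ.symm (h.equiv.symm (ψ x)).1) = _
    rw [hφψ x hx, φ.left_inv (by simpa [φ] using hx)]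
  rw [← key a ha.1, ← key b hb.1]
  exact hC ha.2 hb.2

lemma exists_lipschitz_nhds
    (hX : IsEmbeddedSubmanifold n X)
    (x₀ : X) : ∃ U ∈ 𝓝 x₀, ∃ L : Set X, IsCompact L ∧ ∃ C : ℝ≥0, ∃ ξ : Fin n → VectorField n X,
      ∀ (f : SmoothFun n X) (M : ℝ≥0), (∀ i, ∀ x ∈ L, ‖lieDeriv (ξ i) f x‖ₑ ≤ M) →
        ∀ a ∈ U, ∀ b ∈ U, edist (f a) (f b) ≤ C * M * edist (a : EuclideanSpace ℝ (Fin d)) b := by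
  obtain ⟨ξ, hξ⟩ := exists_coordFields (n := n) x₀
  obtain ⟨C, U, hU, hC⟩ := exists_lipschitz_chart hX x₀
  let φ := extChartAt (𝓡 n) x₀
  have hev : ∀ᶠ y in 𝓝 (φ x₀), y ∈ φ.target ∧ ∀ i, ξ i (φ.symm y) =
      mfderiv 𝓘(ℝ, EuclideanSpace ℝ (Fin n)) (𝓡 n) φ.symm (φ (φ.symm y))
        (EuclideanSpace.single i (1 : ℝ)) := by
    refine Filter.Eventually.and (extChartAt_target_mem_nhds (I := 𝓡 n) x₀) ?_
    have := continuousAt_extChartAt_symm (I := 𝓡 n) x₀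
    rw [ContinuousAt, extChartAt_to_inv] at this
    exact this.eventually hξ
  obtain ⟨r, hr, hball⟩ := Metric.nhds_basis_closedBall.mem_iff.1 hev
  refine ⟨U ∩ (φ.source ∩ φ ⁻¹' Metric.closedBall (φ x₀) r), inter_mem hU (inter_mem
      (extChartAt_source_mem_nhds x₀) ((continuousAt_extChartAt x₀) (Metric.closedBall_mem_nhds _ hr))),
    φ.symm '' Metric.closedBall (φ x₀) r, ?_, n * C, ξ, fun f M hM a ha b hb ↦ ?_⟩
  · exact (isCompact_closedBall _ _).image_of_continuousOn
      ((continuousOn_extChartAt_symm x₀).mono fun y hy ↦ (hball hy).1)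
  have hd : ∀ y ∈ Metric.closedBall (φ x₀) r, ∃ D : EuclideanSpace ℝ (Fin n) →L[ℝ] ℂ,
      HasFDerivWithinAt (f ∘ φ.symm) D (Metric.closedBall (φ x₀) r) y ∧ ‖D‖ ≤ n * M := by
    intro y hy
    have hφ : MDifferentiableAt 𝓘(ℝ, EuclideanSpace ℝ (Fin n)) (𝓡 n) φ.symm y :=
      ((contMDiffOn_extChartAt_symm (n := 1) x₀).contMDiffAt
        ((isOpen_extChartAt_target x₀).mem_nhds (hball hy).1)).mdifferentiableAt (by simp)
    have hf : MDifferentiableAt (𝓡 n) 𝓘(ℝ, ℂ) f (φ.symm y) := f.mdifferentiableAt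
    have hcomp := hf.hasMFDerivAt.comp y hφ.hasMFDerivAt
    refine ⟨_, (hasMFDerivAt_iff_hasFDerivAt.1 hcomp).hasFDerivWithinAt, ?_⟩
    set D : EuclideanSpace ℝ (Fin n) →L[ℝ] ℂ := (mfderiv (𝓡 n) 𝓘(ℝ, ℂ) f (φ.symm y)).comp
      (mfderiv 𝓘(ℝ, EuclideanSpace ℝ (Fin n)) (𝓡 n) φ.symm y) with hD
    have hDi : ∀ i, ‖D (EuclideanSpace.single i (1 : ℝ))‖ ≤ M := by
      intro i
      have h1 := hM i _ (mem_image_of_mem _ hy)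
      have h2 := (hball hy).2 i
      rw [φ.right_inv (hball hy).1] at h2
      have h3 : D (EuclideanSpace.single i (1 : ℝ)) = lieDeriv (ξ i) f (φ.symm y) := by
        change _ = mfderiv (𝓡 n) 𝓘(ℝ, ℂ) f (φ.symm y) (ξ i (φ.symm y))
        rw [h2]; rfl
      rw [h3]
      rw [← enorm_norm, Real.enorm_of_nonneg (norm_nonneg _)] at h1
      simpa using ENNReal.toReal_mono ENNReal.coe_ne_top h1
    refine D.opNorm_le_bound (by positivity) fun v ↦ ?_
    have hv : v = ∑ i, v i • EuclideanSpace.single i (1 : ℝ) := by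
      ext j
      simp [Finset.sum_apply, Pi.single_apply]
    calc ‖D v‖ = ‖∑ i, v i • D (EuclideanSpace.single i (1 : ℝ))‖ := by
          conv_lhs => rw [hv]
          simp only [map_sum, map_smul]
      _ ≤ ∑ i : Fin n, ‖v‖ * M := by
          refine (norm_sum_le _ _).trans (Finset.sum_le_sum fun i _ ↦ ?_)
          rw [norm_smul]
          exact mul_le_mul (EuclideanSpace.norm_eq v ▸ PiLp.norm_apply_le v i) (hDi i) (norm_nonneg _) (norm_nonneg _)
      _ = n * M * ‖v‖ := by simp; ring
  choose! D hD1 hD2 using hd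
  have hmv := (convex_closedBall (φ x₀) r).norm_image_sub_le_of_norm_hasFDerivWithin_le hD1 hD2 hb.2.2 ha.2.2
  simp only [Function.comp] at hmv
  rw [φ.left_inv ha.2.1, φ.left_inv hb.2.1] at hmv
  have hmv' : edist (f a) (f b) ≤ (n * M : ℝ≥0) * edist (φ a) (φ b) := by
    rw [edist_nndist, edist_nndist, ← ENNReal.coe_mul, ENNReal.coe_le_coe, ← NNReal.coe_le_coe]
    push_cast
    rwa [dist_eq_norm, dist_eq_norm]
  calc edist (f a) (f b) ≤ (n * M : ℝ≥0) * edist (φ a) (φ b) := hmv'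
    _ ≤ (n * M : ℝ≥0) * (C * edist (a : EuclideanSpace ℝ (Fin d)) b) := by
      gcongr; exact hC a ha.1 b hb.1
    _ = _ := by push_cast; ring

/-- A moderate net satisfies a moderate local Lipschitz estimate near compact sets. -/
lemma exists_lipschitz_compact (hX : IsEmbeddedSubmanifold n X) (u : moderateNets n X)
    {K : Set X} (hK : IsCompact K) :
    ∃ b : ℝ, ∃ C : ℝ≥0, ∃ ε₀ > (0 : ℝ), ∃ δ > (0 : ℝ≥0∞), ∀ ε : Eps, (ε : ℝ) < ε₀ →
      ∀ x ∈ K, ∀ y : X, edist x y < δ →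
        edist (u.1 ε x) (u.1 ε y) ≤ C * ENNReal.ofReal ((ε : ℝ) ^ b) * edist x y := by
  refine hK.induction_on ?_ ?_ ?_ ?_
  · exact ⟨0, 0, 1, one_pos, 1, one_pos, fun _ _ _ h ↦ h.elim⟩
  · intro s t hst ht
    obtain ⟨b, C, e, he, δ, hδ, h⟩ := ht
    exact ⟨b, C, e, he, δ, hδ, fun ε hε x hx ↦ h ε hε x (hst hx)⟩
  · intro s t hs ht
    obtain ⟨b, C, e, he, δ, hδ, h⟩ := hs
    obtain ⟨b', C', e', he', δ', hδ', h'⟩ := ht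
    refine ⟨min b b', max C C', min e e', lt_min he he', min δ δ', lt_min hδ hδ',
      fun ε hε x hx y hy ↦ ?_⟩
    have hw : ∀ c : ℝ, min b b' ≤ c →
        ENNReal.ofReal ((ε : ℝ) ^ c) ≤ ENNReal.ofReal ((ε : ℝ) ^ min b b') := fun c hc ↦
      ENNReal.ofReal_le_ofReal (Real.rpow_le_rpow_of_exponent_ge ε.2.1 ε.2.2.le hc)
    rcases hx with hx | hx
    · refine (h ε (hε.trans_le (min_le_left _ _)) x hx y
        (hy.trans_le (min_le_left _ _))).trans ?_
      exact mul_le_mul' (mul_le_mul' (ENNReal.coe_le_coe.2 (le_max_left _ _))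
        (hw _ (min_le_left _ _))) le_rfl
    · refine (h' ε (hε.trans_le (min_le_right _ _)) x hx y
        (hy.trans_le (min_le_right _ _))).trans ?_
      exact mul_le_mul' (mul_le_mul' (ENNReal.coe_le_coe.2 (le_max_right _ _))
        (hw _ (min_le_right _ _))) le_rfl
  · intro x₀ _
    obtain ⟨U, hU, L, hL, C, ξ, hξ⟩ := exists_lipschitz_nhds hX x₀
    obtain ⟨b, hb⟩ := u.2 L hL 1
    have hM : ∃ M : ℝ≥0, ∃ e > (0 : ℝ), ∀ ε : Eps, (ε : ℝ) < e → ∀ i,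
        supOn L (lieDeriv (ξ i) (u.1 ε)) ≤ M * ENNReal.ofReal ((ε : ℝ) ^ b) := by
      choose M e he h using fun i ↦ hb [ξ i] rfl
      by_cases hn : Nonempty (Fin n)
      · refine ⟨∑ i, M i, Finset.univ.inf' Finset.univ_nonempty e,
          (Finset.lt_inf'_iff _).2 fun i _ ↦ he i, fun ε hε i ↦ ?_⟩
        refine (h i ε (hε.trans_le (Finset.inf'_le _ (Finset.mem_univ i)))).trans ?_
        gcongr
        exact Finset.single_le_sum (f := M) (fun _ _ ↦ zero_le) (Finset.mem_univ i)
      · exact ⟨0, 1, one_pos, fun ε _ i ↦ (hn ⟨i⟩).elim⟩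
    obtain ⟨M, e, he, hM⟩ := hM
    obtain ⟨δ, hδ, hball⟩ := Metric.mem_nhds_iff.1 hU
    refine ⟨Metric.ball x₀ (δ / 2), mem_nhdsWithin_of_mem_nhds
      (Metric.ball_mem_nhds _ (half_pos hδ)), b, C * M, e, he,
      ENNReal.ofReal (δ / 2), by simpa using hδ, fun ε hε x hx y hy ↦ ?_⟩
    have hxy : dist x y < δ / 2 := by
      rw [edist_dist] at hy
      exact (ENNReal.ofReal_lt_ofReal_iff (half_pos hδ)).1 hy
    have hx' : dist x x₀ < δ / 2 := hx
    have hyU : y ∈ U := hball (by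
      have := dist_triangle_left y x₀ x
      rw [Metric.mem_ball]
      linarith)
    have hxU : x ∈ U := hball (by rw [Metric.mem_ball]; linarith)
    have := hξ (u.1 ε) (M * Real.toNNReal ((ε : ℝ) ^ b)) (fun i z hz ↦ by
      refine (le_supOn _ hz).trans ((hM ε hε i).trans_eq ?_)
      push_cast
      rfl) x hxU y hyU
    refine this.trans_eq ?_
    push_cast
    rw [← mul_assoc (C : ℝ≥0∞)]
    rfl

/-- The net of numbers `(u_ε(p_ε))_ε`. -/
def evalNet (p : CompactNet X) : moderateNets n X →+ moderateNumbers where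
  toFun u := ⟨fun ε ↦ u.1 ε (p.1 ε), by
    obtain ⟨K, hK, hp⟩ := p.2
    obtain ⟨b, h⟩ := u.2 K hK 0
    obtain ⟨e, he, hp⟩ := hp
    exact ⟨b, (h [] rfl).mono ⟨e, he, fun ε hε ↦ le_supOn _ (hp ε hε)⟩⟩⟩
  map_zero' := rfl
  map_add' _ _ := rfl

/-- The value of a generalized function at (the class of) a compactly supported net. -/
def valueAtNet (p : CompactNet X) : GenFun n X →+ GenNumber :=
  QuotientAddGroup.map _ _ (evalNet p) (by
    intro u hu b
    obtain ⟨K, hK, e, he, hp⟩ := p.2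
    exact (hu K hK b).mono ⟨e, he, fun ε hε ↦ le_supOn _ (hp ε hε)⟩)

lemma valueAtNet_congr (hX : IsEmbeddedSubmanifold n X) {p q : CompactNet X}
    (h : IsNegligible fun ε ↦ riemDist n (p.1 ε) (q.1 ε)) (u : GenFun n X) :
    valueAtNet p u = valueAtNet q u := by
  induction u using QuotientAddGroup.induction_on with
  | H u =>
    change ((evalNet p u : moderateNumbers) : GenNumber) = (evalNet q u : moderateNumbers)
    rw [QuotientAddGroup.eq_iff_sub_mem]
    intro b
    obtain ⟨K, hK, e, he, hp⟩ := p.2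
    obtain ⟨c, C, e', he', δ, hδ, hl⟩ := exists_lipschitz_compact hX u hK
    have h0 : IsNegligible fun ε ↦ edist (p.1 ε) (q.1 ε) := fun b ↦
      (h b).mono_le fun ε ↦ edist_le_riemDist hX _ _
    have hC : IsBigOPow (fun ε : Eps ↦ C * ENNReal.ofReal ((ε : ℝ) ^ c)) c :=
      ⟨C, 1, one_pos, fun _ _ ↦ le_rfl⟩
    have hmul := hC.mul (h0 (b - c))
    rw [add_sub_cancel] at hmul
    obtain ⟨A, e₁, he₁, hA⟩ := h0 1
    have hsmall : ∃ e₂ > (0 : ℝ), ∀ ε : Eps, (ε : ℝ) < e₂ →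
        (A : ℝ≥0∞) * ENNReal.ofReal ((ε : ℝ) ^ (1 : ℝ)) < δ := by
      have ht : Tendsto (fun t : ℝ ↦ (A : ℝ≥0∞) * ENNReal.ofReal (t ^ (1 : ℝ))) (𝓝 0) (𝓝 0) := by
        have h1 : Tendsto (fun t : ℝ ↦ ENNReal.ofReal (t ^ (1 : ℝ))) (𝓝 0) (𝓝 0) := by
          simpa using (ENNReal.continuous_ofReal.tendsto (0 : ℝ))
        simpa using ENNReal.Tendsto.const_mul (a := (A : ℝ≥0∞)) h1 (Or.inr ENNReal.coe_ne_top)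
      obtain ⟨e₂, he₂, h₂⟩ := Metric.eventually_nhds_iff.1 (ht.eventually_lt_const hδ)
      refine ⟨e₂, he₂, fun ε hε ↦ h₂ ?_⟩
      simpa [abs_of_pos ε.2.1] using hε
    obtain ⟨e₂, he₂, h₂⟩ := hsmall
    refine hmul.mono ⟨min (min e e') (min e₁ e₂), by positivity, fun ε hε ↦ ?_⟩
    simp only [lt_min_iff] at hε
    obtain ⟨⟨hε, hε'⟩, hε₁, hε₂⟩ := hε
    have := hl ε hε' (p.1 ε) (hp ε hε) (q.1 ε) ((hA ε hε₁).trans_lt (h₂ ε hε₂))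
    rwa [edist_eq_enorm_sub] at this

/-- The point value `u(p)` of `u ∈ 𝒢(X)` at `p ∈ X̃_c`: the class of `(u_ε(p_ε))_ε`. -/
def pointValue (hX : IsEmbeddedSubmanifold n X) (u : GenFun n X) (p : GenPoint n X) : GenNumber :=
  Quotient.lift (fun p : CompactNet X ↦ valueAtNet p u)
    (fun _ _ h ↦ valueAtNet_congr hX h u) p

/-- The `j`-th coordinate of a compactly supported net, as a net of numbers. -/
def coordNet (p : CompactNet X) (j : Fin d) : moderateNumbers :=
  ⟨fun ε ↦ (((p.1 ε : EuclideanSpace ℝ (Fin d)) j : ℝ) : ℂ), by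
    obtain ⟨K, hK, e, he, hp⟩ := p.2
    obtain ⟨C, hC⟩ := (hK.image continuous_subtype_val).isBounded.exists_norm_le
    refine ⟨0, C.toNNReal, e, he, fun ε hε ↦ ?_⟩
    have h1 := hC _ (mem_image_of_mem _ (hp ε hε))
    have h2 := PiLp.norm_apply_le (p.1 ε : EuclideanSpace ℝ (Fin d)) j
    simp only [Real.rpow_zero, ENNReal.ofReal_one, mul_one]
    rw [← ofReal_norm]
    refine ENNReal.ofReal_le_ofReal ?_
    rw [Complex.norm_real]
    exact h2.trans h1⟩

/-- The injection `X̃_c → ℝ̃^d ⊆ ℂ̃^d` that is the identity on representatives. -/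
def pointCoords (hX : IsEmbeddedSubmanifold n X) (p : GenPoint n X) : Fin d → GenNumber :=
  Quotient.lift (fun (p : CompactNet X) (j : Fin d) ↦ ((coordNet p j : moderateNumbers) : GenNumber))
    (fun p q h ↦ by
      ext j
      rw [QuotientAddGroup.eq_iff_sub_mem]
      intro b
      refine (h b).mono_le fun ε ↦ le_trans ?_ (edist_le_riemDist hX _ _)
      change ‖(((p.1 ε : EuclideanSpace ℝ (Fin d)) j : ℝ) : ℂ) -
        (((q.1 ε : EuclideanSpace ℝ (Fin d)) j : ℝ) : ℂ)‖ₑ ≤ _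
      rw [← Complex.ofReal_sub, edist_eq_enorm_sub, ← ofReal_norm, ← ofReal_norm,
        Complex.norm_real]
      exact ENNReal.ofReal_le_ofReal (PiLp.norm_apply_le
        ((p.1 ε : EuclideanSpace ℝ (Fin d)) - (q.1 ε : EuclideanSpace ℝ (Fin d))) j)) p

/-! ### c-boundedness -/

/-- The inclusion `ℝ^m ⊆ ℂ^m`, for the Euclidean norms. -/
def toComplex {m : ℕ} (y : EuclideanSpace ℝ (Fin m)) : EuclideanSpace ℂ (Fin m) :=
  WithLp.toLp 2 fun j ↦ (y j : ℂ)

/-- A subset `K'` of `Y ⊆ ℝ^m`, as a subset of `ℂ^m`. -/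
def complexSet {m : ℕ} {Y : Set (EuclideanSpace ℝ (Fin m))} (K' : Set Y) :
    Set (EuclideanSpace ℂ (Fin m)) :=
  (fun y : Y ↦ toComplex (y : EuclideanSpace ℝ (Fin m))) '' K'

/-- `U` is a representative of `u ∈ 𝒢(X)^m`. -/
def IsRepresentative {m : ℕ} (U : Fin m → moderateNets n X) (u : Fin m → GenFun n X) : Prop :=
  ∀ j, ((U j : moderateNets n X) : GenFun n X) = u j

/-- The vector `u_ε(x) ∈ ℂ^m`, for a net `(u_ε)_ε` with `m` components. -/
def netValue {m : ℕ} (U : Fin m → moderateNets n X) (ε : Eps) (x : X) : EuclideanSpace ℂ (Fin m) :=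
  WithLp.toLp 2 fun j ↦ (U j).1 ε x

/-- `u ∈ 𝒢(X)^m` is c-bounded into `Y ⊆ ℝ^m`: it has a representative that, for small `ε`, maps
a given compact subset of `X` into a compact subset of `Y` that does not depend on `ε`. -/
def IsCBounded {m : ℕ} (u : Fin m → GenFun n X) (Y : Set (EuclideanSpace ℝ (Fin m))) : Prop :=
  ∃ U : Fin m → moderateNets n X, IsRepresentative U u ∧
    ∀ K : Set X, IsCompact K → ∃ K' : Set Y, IsCompact K' ∧
      ∃ ε₀ > (0 : ℝ), ∀ ε : Eps, (ε : ℝ) ≤ ε₀ → MapsTo (netValue U ε) K (complexSet K')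

/-- Each compact `K ⊆ X` has a compact `K' ⊆ Y` such that
`sup_{x ∈ K} d(u_ε(x), K') = O(ε ^ m)` for all `m`. The distance to the empty set is `∞`. -/
def IsNegligiblyCloseTo {m : ℕ} (U : Fin m → moderateNets n X)
    (Y : Set (EuclideanSpace ℝ (Fin m))) : Prop :=
  ∀ K : Set X, IsCompact K → ∃ K' : Set Y, IsCompact K' ∧ ∀ k : ℕ,
    IsBigOPow (fun ε ↦ ⨆ x ∈ K, Metric.infEDist (netValue U ε x) (complexSet K')) k

end Manifold

end Colombeau

end

open Colombeau

namespace Colombeau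

set_option linter.unusedSectionVars false

/-! Two implications carry the content: from closeness to `Y` to values in `Y` (2 to 1), and from
single generalized points to estimates uniform on compact sets (4 to 2). The others follow from the
triangle inequality and from choosing nearest points in the compact set `K'`.

For 2 to 1, the nearest-point projection `π` is a smooth retraction of a neighborhood `T` of `Y`
onto `Y` (`exists_contDiffOn_retraction`). The real part of `u_ε` maps a given compact set into `T`
only for small `ε`, and how small depends on the set. So for each `ε` the map `π ∘ Re u_ε` is
extended to all of `X` from a member of a compact exhaustion, with larger members as `ε` decreases
(`IsNegligiblyCloseTo.exists_comp`). On a given compact set and for small `ε`, the result is `g ∘ Re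
u_ε` with one compactly supported `g` that equals `π` near `K'`. The chain rule makes this net
moderate, the Lipschitz constant of `g` makes its distance to `u_ε` negligible, and compactness of
the image under `g` gives c-boundedness. Derivatives of the difference need no estimate, since
negligibility of a moderate net is a condition on values only.

For 4 to 2, condition 4 is tested on nets of worst points of `K`. A first such net shows that
`u_ε(K)` lies within `ε` of one fixed compact subset of `Y` (`exists_eventually_infEDist_le`). A
second one, maximizing the distance to a slightly larger compact set, turns this into negligibility
(`isNegligiblyCloseTo_of_forall_compactNet`). -/

/-! ### The nearest-point retraction onto an embedded submanifold -/

/-- The inverse function theorem, with an inverse that is smooth on its whole domain. -/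
lemma exists_openPartialHomeomorph_contDiffOn_symm {E F : Type*}
    [NormedAddCommGroup E] [NormedSpace ℝ E] [CompleteSpace E]
    [NormedAddCommGroup F] [NormedSpace ℝ F]
    {f : E → F} {U : Set E} (hU : IsOpen U) (hf : ContDiffOn ℝ ∞ f U) {a : E} (ha : a ∈ U)
    {f' : E ≃L[ℝ] F} (hf' : HasFDerivAt f (f' : E →L[ℝ] F) a) :
    ∃ P : OpenPartialHomeomorph E F, a ∈ P.source ∧ P.source ⊆ U ∧ (∀ x, P x = f x) ∧
      ContDiffOn ℝ ∞ P.symm P.target := by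
  have hfa : ContDiffAt ℝ ∞ f a := hf.contDiffAt (hU.mem_nhds ha)
  let P₀ := hfa.toOpenPartialHomeomorph f hf' (by simp)
  have hcont : ContinuousOn (fderiv ℝ f) U := hf.continuousOn_fderiv_of_isOpen hU (by simp)
  -- The local inverse is smooth at the images of points with invertible derivative. Invertibility
  -- is an open condition, so the source can be cut down to such points.
  let V : Set E := U ∩ fderiv ℝ f ⁻¹' range ((↑) : (E ≃L[ℝ] F) → E →L[ℝ] F)
  have hV : IsOpen V := hcont.isOpen_inter_preimage hU ContinuousLinearEquiv.isOpen
  refine ⟨P₀.restr V, ?_, ?_, fun x ↦ rfl, ?_⟩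
  · rw [OpenPartialHomeomorph.restr_source' _ _ hV]
    exact ⟨hfa.mem_toOpenPartialHomeomorph_source hf' (by simp), ha, f', hf'.fderiv.symm⟩
  · rw [OpenPartialHomeomorph.restr_source' _ _ hV]
    exact fun x hx ↦ hx.2.1
  · intro y hy
    have hy' := (P₀.restr V).map_target hy
    rw [OpenPartialHomeomorph.restr_source' _ _ hV] at hy'
    obtain ⟨g, hg⟩ := hy'.2.2
    have hd : ContDiffAt ℝ ∞ f ((P₀.restr V).symm y) := hf.contDiffAt (hU.mem_nhds hy'.2.1)
    refine ((P₀.restr V).contDiffAt_symm hy (f₀' := g) ?_ hd).contDiffWithinAt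
    rw [hg]
    exact (hd.differentiableAt (by simp)).hasFDerivAt

variable {E F : Type*} [NormedAddCommGroup E] [NormedSpace ℝ E] [FiniteDimensional ℝ E]
  [NormedAddCommGroup F] [InnerProductSpace ℝ F] [FiniteDimensional ℝ F]

/-- Near a point of a parametrized immersed submanifold, the critical points of the distance
functions depend smoothly on the base point. -/
lemma exists_contDiffOn_critical_point {f : E → F} {U : Set E} (hU : IsOpen U)
    (hf : ContDiffOn ℝ ∞ f U) {s₀ : E} (hs₀ : s₀ ∈ U)
    (hinj : Function.Injective (fderiv ℝ f s₀)) :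
    ∃ σ : F → E, ∃ V : Set F, IsOpen V ∧ f s₀ ∈ V ∧ ContDiffOn ℝ ∞ σ V ∧ MapsTo σ V U ∧
      ∃ W ∈ 𝓝 s₀, ∀ z ∈ V, ∀ s ∈ W,
        (∀ v, inner ℝ (f s - z) (fderiv ℝ f s v) = 0) → s = σ z := by
  -- The first component vanishes exactly when `s` is critical for the squared distance from `f s`
  -- to `z`. Carrying `z` along as second component lets the inverse function theorem solve this
  -- equation for `s`.
  let Φ : E × F → (E →L[ℝ] ℝ) × F := fun p ↦
    ((innerSL ℝ (f p.1 - p.2)).comp (fderiv ℝ f p.1), p.2)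
  have hfst : MapsTo (Prod.fst : E × F → E) (U ×ˢ univ) U := fun p hp ↦ hp.1
  have hΦ : ContDiffOn ℝ ∞ Φ (U ×ˢ univ) := by
    have h1 : ContDiffOn ℝ ∞ (fun p : E × F ↦ f p.1) (U ×ˢ univ) :=
      hf.comp contDiff_fst.contDiffOn hfst
    have h2 : ContDiffOn ℝ ∞ (fun p : E × F ↦ fderiv ℝ f p.1) (U ×ˢ univ) :=
      (hf.fderiv_of_isOpen hU (m := ∞) (by simp)).comp contDiff_fst.contDiffOn hfst
    exact (((innerSL ℝ).contDiff.comp_contDiffOn (h1.sub contDiff_snd.contDiffOn)).clm_comp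
      h2).prodMk contDiff_snd.contDiffOn
  have hmem : (s₀, f s₀) ∈ U ×ˢ (univ : Set F) := ⟨hs₀, trivial⟩
  have hopen : IsOpen (U ×ˢ (univ : Set F)) := hU.prod isOpen_univ
  have hΦd := ((hΦ.contDiffAt (hopen.mem_nhds hmem)).differentiableAt (by simp)).hasFDerivAt
  set Φ' := fderiv ℝ Φ (s₀, f s₀) with hΦ'
  -- The term with the second derivative of `f` is paired with `f s₀ - f s₀ = 0` and drops out.
  have hformula : ∀ p : E × F, Φ' p =
      ((innerSL ℝ (fderiv ℝ f s₀ p.1 - p.2)).comp (fderiv ℝ f s₀), p.2) := by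
    have h1 : HasFDerivAt (fun p : E × F ↦ f p.1)
        ((fderiv ℝ f s₀).comp (.fst ℝ E F)) (s₀, f s₀) :=
      ((hf.contDiffAt (hU.mem_nhds hs₀)).differentiableAt (by simp)).hasFDerivAt.comp _
        hasFDerivAt_fst
    have h2 : HasFDerivAt (fun p : E × F ↦ fderiv ℝ f p.1)
        ((fderiv ℝ (fderiv ℝ f) s₀).comp (.fst ℝ E F)) (s₀, f s₀) :=
      ((((hf.fderiv_of_isOpen hU (m := ∞) (by simp)).contDiffAt
        (hU.mem_nhds hs₀)).differentiableAt (by simp)).hasFDerivAt).comp (s₀, f s₀)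
        (hasFDerivAt_fst (𝕜 := ℝ) (p := (s₀, f s₀)))
    have h3 := (((innerSL ℝ : F →L[ℝ] F →L[ℝ] ℝ).hasFDerivAt.comp (s₀, f s₀)
      (h1.sub hasFDerivAt_snd)).clm_comp h2).prodMk (hasFDerivAt_snd (𝕜 := ℝ) (p := (s₀, f s₀)))
    intro p
    have h4 : Φ' = _ := HasFDerivAt.unique hΦd h3
    rw [h4]
    ext
    · simp
      rfl
    · simp
  have hinjΦ : Function.Injective Φ' := by
    rw [injective_iff_map_eq_zero]
    rintro ⟨v, w⟩ h
    rw [hformula, Prod.mk_eq_zero] at h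
    obtain ⟨h, rfl : w = 0⟩ := h
    -- Evaluated at `v` itself, the functional gives the squared norm of `fderiv ℝ f s₀ v`.
    have := DFunLike.congr_fun h v
    simp only [sub_zero, ContinuousLinearMap.comp_apply, zero_apply, innerSL_apply_apply,
      inner_self_eq_zero] at this
    rw [(injective_iff_map_eq_zero _).1 hinj v this]
    rfl
  have hdim : Module.finrank ℝ (E × F) = Module.finrank ℝ ((E →L[ℝ] ℝ) × F) := by
    have : Module.finrank ℝ (E →L[ℝ] ℝ) = Module.finrank ℝ E := by
      rw [← (LinearMap.toContinuousLinearMap (𝕜 := ℝ) (E := E) (F' := ℝ)).finrank_eq]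
      exact Subspace.dual_finrank_eq
    rw [Module.finrank_prod, Module.finrank_prod, this]
  let e : (E × F) ≃L[ℝ] ((E →L[ℝ] ℝ) × F) :=
    (LinearEquiv.ofInjectiveOfFinrankEq Φ'.toLinearMap hinjΦ hdim).toContinuousLinearEquiv
  have he : (e : (E × F) →L[ℝ] ((E →L[ℝ] ℝ) × F)) = Φ' := by
    ext <;> rfl
  have := FiniteDimensional.complete ℝ E
  have := FiniteDimensional.complete ℝ F
  obtain ⟨P, haP, hPU, hP, hPs⟩ := exists_openPartialHomeomorph_contDiffOn_symm hopen hΦ hmem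
    (f' := e) (he ▸ hΦd)
  have hΦ0 : Φ (s₀, f s₀) = (0, f s₀) := by simp [Φ]
  have hι : Continuous fun z : F ↦ ((0 : E →L[ℝ] ℝ), z) := by fun_prop
  -- A product neighborhood inside the source makes the uniqueness region `W = A` independent of
  -- `z`.
  obtain ⟨A, hA, B, hB, hAB⟩ := mem_nhds_prod_iff.1 (P.open_source.mem_nhds haP)
  refine ⟨fun z ↦ (P.symm (0, z)).1, (fun z : F ↦ ((0 : E →L[ℝ] ℝ), z)) ⁻¹' P.target ∩ interior B,
    (P.open_target.preimage hι).inter isOpen_interior,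
    ⟨?_, mem_interior_iff_mem_nhds.2 hB⟩, ?_, ?_, A, hA, ?_⟩
  · have := P.map_source haP
    rwa [hP, hΦ0] at this
  · refine contDiff_fst.comp_contDiffOn (hPs.comp ?_ fun z hz ↦ hz.1)
    exact (contDiff_const.prodMk contDiff_id).contDiffOn
  · intro z hz
    exact (hPU (P.map_target hz.1)).1
  · intro z hz s hs h
    have h1 : P (s, z) = (0, z) := by
      rw [hP]
      simp only [Φ, Prod.mk.injEq, and_true]
      ext v
      exact h v
    have h2 := P.left_inv (hAB ⟨hs, interior_subset hz.2⟩ : (s, z) ∈ P.source)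
    rw [h1] at h2
    exact (congrArg Prod.fst h2).symm

/-- If `f' v = 0`, then `f` changes by `o(t)` along `a + t • v`; the lower bound on the change of
`f` then forces `t • v = o(t)`, so `v = 0`. This turns a Lipschitz chart into an immersed
parametrization. -/
lemma injective_of_hasFDerivAt_of_le {E F : Type*} [NormedAddCommGroup E] [NormedSpace ℝ E]
    [NormedAddCommGroup F] [NormedSpace ℝ F] {f : E → F} {f' : E →L[ℝ] F} {a : E}
    (hf : HasFDerivAt f f' a) {C : ℝ} (h : ∀ᶠ s in 𝓝 a, ‖s - a‖ ≤ C * ‖f s - f a‖) :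
    Function.Injective f' := by
  rw [injective_iff_map_eq_zero]
  intro v hv
  have hline : HasDerivAt (fun t : ℝ ↦ a + t • v) v 0 := by
    simpa using ((hasDerivAt_id (0 : ℝ)).smul_const v).const_add a
  have ha : a + (0 : ℝ) • v = a := by simp
  have h1 : HasDerivAt (fun t : ℝ ↦ f (a + t • v)) 0 0 := by
    rw [← hv]
    exact HasFDerivAt.comp_hasDerivAt (0 : ℝ) (by rwa [ha]) hline
  have h2 : ∀ᶠ t in 𝓝 (0 : ℝ), ‖t • v‖ ≤ C * ‖f (a + t • v) - f a‖ := by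
    have := hline.continuousAt.tendsto
    simp only [zero_smul, add_zero] at this
    simpa using this.eventually h
  have h3 : HasDerivAt (fun t : ℝ ↦ t • v) 0 0 := by
    rw [hasDerivAt_iff_isLittleO] at h1 ⊢
    refine (Asymptotics.IsBigO.of_bound C ?_).trans_isLittleO h1
    simpa using h2
  exact HasDerivAt.unique (by simpa using (hasDerivAt_id (0 : ℝ)).smul_const v) h3

/-- Keeps the points nearest to `z` inside a chart around `y₀` once `z` is close to `y₀`. -/
lemma dist_le_two_mul_of_isMinOn {α : Type*} [PseudoMetricSpace α] {S : Set α} {y y₀ z : α}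
    (hy : IsMinOn (dist z) S y) (hy₀ : y₀ ∈ S) : dist y y₀ ≤ 2 * dist z y₀ := by
  have h1 : dist z y ≤ dist z y₀ := hy hy₀
  have h2 := dist_triangle_left y y₀ z
  linarith

/-- Points close to a locally compact set have a nearest point in it. -/
lemma eventually_exists_isMinOn_dist {α : Type*} [MetricSpace α] {S : Set α}
    [LocallyCompactSpace S] (y₀ : S) :
    ∀ᶠ z in 𝓝 (y₀ : α), ∃ y ∈ S, IsMinOn (dist z) S y := by
  obtain ⟨L, hL, hLy⟩ := exists_compact_mem_nhds y₀
  obtain ⟨ρ, hρ, hball⟩ := Metric.mem_nhds_iff.1 hLy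
  filter_upwards [Metric.ball_mem_nhds (y₀ : α) (half_pos hρ)] with z hz
  obtain ⟨y, hy, hmin⟩ := hL.exists_isMinOn ⟨y₀, mem_of_mem_nhds hLy⟩
    (f := fun y : S ↦ dist z y) (by fun_prop)
  refine ⟨y, y.2, fun y' hy' ↦ ?_⟩
  have h0 : dist z y ≤ dist z y₀ := hmin (mem_of_mem_nhds hLy)
  -- A competitor at least as far from `z` as `y₀` cannot win; a closer one is within `ρ` of `y₀`
  -- and thus in `L`, where `y` is already minimal.
  rcases le_or_gt (dist z y₀) (dist z y') with h | h
  · exact h0.trans h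
  · refine hmin (a := ⟨y', hy'⟩) (hball ?_)
    have h1 := dist_triangle_left y' y₀ z
    rw [Metric.mem_ball] at hz
    change dist y' (y₀ : α) < ρ
    linarith

/-- Minimality passes to the squared distance, which is differentiable even where the distance
vanishes. -/
lemma inner_fderiv_eq_zero_of_isLocalMin {E F : Type*} [NormedAddCommGroup E] [NormedSpace ℝ E]
    [NormedAddCommGroup F] [InnerProductSpace ℝ F] {f : E → F} {z : F} {s : E}
    (hf : DifferentiableAt ℝ f s) (h : IsLocalMin (fun s' ↦ dist z (f s')) s) (v : E) :
    inner ℝ (f s - z) (fderiv ℝ f s v) = 0 := by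
  have h1 : IsLocalMin (fun s' ↦ ‖f s' - z‖ ^ 2) s := by
    filter_upwards [h] with s' hs'
    simp only [dist_comm z, dist_eq_norm] at hs'
    gcongr
  have h2 := (hf.hasFDerivAt.sub_const z).norm_sq
  have := DFunLike.congr_fun (h1.hasFDerivAt_eq_zero h2) v
  simpa [inner_sub_left] using this

section Manifold

variable {d n : ℕ} {Y : Set (EuclideanSpace ℝ (Fin d))}
  [ChartedSpace (EuclideanSpace ℝ (Fin n)) Y] [IsManifold (𝓡 n) ∞ Y]

/-- Near a point of an embedded submanifold, nearest points exist, are unique, and depend smoothly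
on the given point. -/
lemma exists_contDiffOn_nearest (hY : IsEmbeddedSubmanifold n Y) (y₀ : Y) :
    ∃ τ : EuclideanSpace ℝ (Fin d) → EuclideanSpace ℝ (Fin d),
      ∃ V : Set (EuclideanSpace ℝ (Fin d)), IsOpen V ∧ (y₀ : EuclideanSpace ℝ (Fin d)) ∈ V ∧
      ContDiffOn ℝ ∞ τ V ∧ ∀ z ∈ V, (∃ y ∈ Y, IsMinOn (dist z) Y y) ∧
        ∀ y ∈ Y, IsMinOn (dist z) Y y → y = τ z := by
  have : LocallyCompactSpace Y := ChartedSpace.locallyCompactSpace (EuclideanSpace ℝ (Fin n)) Y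
  let φ := extChartAt (𝓡 n) y₀
  let f : EuclideanSpace ℝ (Fin n) → EuclideanSpace ℝ (Fin d) := fun s ↦ (φ.symm s : _)
  have hU : IsOpen φ.target := isOpen_extChartAt_target y₀
  have hs₀ : φ y₀ ∈ φ.target := mem_extChartAt_target y₀
  have hf : ContDiffOn ℝ ∞ f φ.target := contMDiffOn_iff_contDiffOn.1
    (hY.contMDiff.comp_contMDiffOn (contMDiffOn_extChartAt_symm y₀))
  have hinv : φ.symm (φ y₀) = y₀ := extChartAt_to_inv y₀
  have hfy : f (φ y₀) = y₀ := congrArg Subtype.val hinv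
  have hinj : Function.Injective (fderiv ℝ f (φ y₀)) := by
    obtain ⟨C, U, hUy, hC⟩ := exists_lipschitz_chart hY y₀
    refine injective_of_hasFDerivAt_of_le (C := C)
      ((hf.contDiffAt (hU.mem_nhds hs₀)).differentiableAt (by simp)).hasFDerivAt ?_
    have hcont := continuousAt_extChartAt_symm (I := 𝓡 n) y₀
    rw [ContinuousAt, extChartAt_to_inv] at hcont
    filter_upwards [hcont hUy, hU.mem_nhds hs₀] with s hs hst
    have := hC _ hs y₀ (mem_of_mem_nhds hUy)
    rw [(extChartAt (𝓡 n) y₀).right_inv hst, edist_nndist, edist_nndist, ← ENNReal.coe_mul,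
      ENNReal.coe_le_coe, ← NNReal.coe_le_coe] at this
    rw [hfy, ← dist_eq_norm, ← dist_eq_norm]
    exact_mod_cast this
  obtain ⟨σ, V, hV, hyV, hσ, hσU, W, hW, hcrit⟩ :=
    exists_contDiffOn_critical_point hU hf hs₀ hinj
  rw [hfy] at hyV
  have hev : ∀ᶠ y : Y in 𝓝 y₀, y ∈ φ.source ∧ φ y ∈ W :=
    Filter.Eventually.and (extChartAt_source_mem_nhds (I := 𝓡 n) y₀)
      ((continuousAt_extChartAt (I := 𝓡 n) y₀).eventually hW)
  obtain ⟨ρ, hρ, hball⟩ := Metric.eventually_nhds_iff.1 hev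
  obtain ⟨O, hO, hOopen, hyO⟩ := eventually_nhds_iff.1 (eventually_exists_isMinOn_dist y₀)
  -- With `z` within `ρ / 2` of `y₀`, each nearest point is within `ρ` of `y₀`, hence in the chart
  -- domain and in the uniqueness region `W`.
  refine ⟨fun z ↦ f (σ z), V ∩ O ∩ Metric.ball y₀ (ρ / 2),
    (hV.inter hOopen).inter Metric.isOpen_ball,
    ⟨⟨hyV, hyO⟩, Metric.mem_ball_self (half_pos hρ)⟩,
    (hf.comp hσ hσU).mono fun z hz ↦ hz.1.1, fun z hz ↦ ⟨hO z hz.1.2, fun y hy hmin ↦ ?_⟩⟩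
  have hd := dist_le_two_mul_of_isMinOn hmin y₀.2
  have hz2 : dist z y₀ < ρ / 2 := hz.2
  obtain ⟨hys, hyW⟩ := hball (y := ⟨y, hy⟩) (by change dist y (y₀ : EuclideanSpace ℝ (Fin d)) < ρ; linarith)
  have hyt := φ.map_source hys
  have hyf : f (φ ⟨y, hy⟩) = y := congrArg Subtype.val (φ.left_inv hys)
  have h0 := hcrit z hz.1.1 _ hyW (inner_fderiv_eq_zero_of_isLocalMin
    ((hf.contDiffAt (hU.mem_nhds hyt)).differentiableAt (by simp)) (by
      refine Eventually.of_forall fun s ↦ ?_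
      simp only [hyf]
      exact hmin (φ.symm s).2))
  change y = f (σ z)
  rw [← h0, hyf]

/-- An embedded submanifold is a smooth retract of a neighborhood. -/
theorem exists_contDiffOn_retraction (hY : IsEmbeddedSubmanifold n Y) :
    ∃ π : EuclideanSpace ℝ (Fin d) → EuclideanSpace ℝ (Fin d),
      ∃ T : Set (EuclideanSpace ℝ (Fin d)), IsOpen T ∧ Y ⊆ T ∧ ContDiffOn ℝ ∞ π T ∧
        MapsTo π T Y ∧ ∀ y ∈ Y, π y = y := by
  choose τ V hV hyV hτ h using exists_contDiffOn_nearest hY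
  -- One arbitrary choice of nearest points suffices: uniqueness on `V y₀` identifies it there with
  -- the smooth `τ y₀`, so no gluing is needed.
  let π : EuclideanSpace ℝ (Fin d) → EuclideanSpace ℝ (Fin d) := fun z ↦
    Classical.epsilon fun y ↦ y ∈ Y ∧ IsMinOn (dist z) Y y
  have hπ : ∀ y₀, ∀ z ∈ V y₀, π z ∈ Y ∧ IsMinOn (dist z) Y (π z) := fun y₀ z hz ↦
    Classical.epsilon_spec (p := fun y ↦ y ∈ Y ∧ IsMinOn (dist z) Y y) (h y₀ z hz).1
  have hYV : Y ⊆ ⋃ y₀, V y₀ := fun y hy ↦ mem_iUnion.2 ⟨⟨y, hy⟩, hyV _⟩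
  refine ⟨π, ⋃ y₀, V y₀, isOpen_iUnion hV, hYV, ?_, ?_, ?_⟩
  · intro z hz
    obtain ⟨y₀, hz⟩ := mem_iUnion.1 hz
    refine (((hτ y₀).contDiffAt ((hV y₀).mem_nhds hz)).congr_of_eventuallyEq ?_).contDiffWithinAt
    filter_upwards [(hV y₀).mem_nhds hz] with w hw
    exact (h y₀ w hw).2 _ (hπ y₀ w hw).1 (hπ y₀ w hw).2
  · intro z hz
    obtain ⟨y₀, hz⟩ := mem_iUnion.1 hz
    exact (hπ y₀ z hz).1
  · intro y hy
    have h1 := (hπ ⟨y, hy⟩ y (hyV _)).2 hy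
    change dist y (π y) ≤ dist y y at h1
    rw [dist_self] at h1
    exact (dist_le_zero.1 h1).symm

end Manifold

/-! ### Smooth extension from compact sets -/

/-- A map that is smooth near a compact set agrees there with a smooth map of compact support. -/
lemma exists_contMDiff_eqOn_of_isCompact {n : ℕ} {M : Type*} [TopologicalSpace M] [T2Space M]
    [SigmaCompactSpace M] [ChartedSpace (EuclideanSpace ℝ (Fin n)) M] [IsManifold (𝓡 n) ∞ M]
    {F : Type*} [NormedAddCommGroup F] [NormedSpace ℝ F] {C Ω : Set M} (hC : IsCompact C)
    (hΩ : IsOpen Ω) (hCΩ : C ⊆ Ω) {h : M → F} (hh : ContMDiffOn (𝓡 n) 𝓘(ℝ, F) ∞ h Ω) :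
    ∃ f : M → F, ContMDiff (𝓡 n) 𝓘(ℝ, F) ∞ f ∧ HasCompactSupport f ∧ EqOn f h C := by
  have : LocallyCompactSpace M := ChartedSpace.locallyCompactSpace (EuclideanSpace ℝ (Fin n)) M
  obtain ⟨L, hL, hCL, hLΩ⟩ := exists_compact_between hC hΩ hCΩ
  obtain ⟨χ, hχ1, hχ0, -⟩ := exists_contMDiffMap_one_nhds_of_subset_interior (n := ⊤) (𝓡 n)
    hC.isClosed hCL
  have hzero : ∀ x ∉ L, χ x • h x = 0 := fun x hx ↦ by rw [hχ0 x hx, zero_smul]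
  refine ⟨fun x ↦ χ x • h x, fun x ↦ ?_, HasCompactSupport.intro hL hzero, fun x hx ↦ ?_⟩
  · by_cases hx : x ∈ Ω
    · exact χ.contMDiff.contMDiffAt.smul (hh.contMDiffAt (hΩ.mem_nhds hx))
    · refine (contMDiffAt_const (c := (0 : F))).congr_of_eventuallyEq ?_
      filter_upwards [hL.isClosed.isOpen_compl.mem_nhds fun hxL ↦ hx (hLΩ hxL)] with y hy
      exact hzero y hy
  · have h1 : χ x = 1 := hχ1.self_of_nhdsSet x hx
    simp only [h1, one_smul]

instance : ContMDiffMul 𝓘(ℝ, ℂ) ∞ ℂ where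
  contMDiff_mul := (contDiff_mul (𝕜 := ℝ) (𝔸 := ℂ)).comp_contMDiff
    (contMDiff_fst.prodMk_space contMDiff_snd)

section Manifold

variable {d n : ℕ} {X : Set (EuclideanSpace ℝ (Fin d))}
  [ChartedSpace (EuclideanSpace ℝ (Fin n)) X] [IsManifold (𝓡 n) ∞ X]

/-! ### Calculus of Lie derivatives -/

lemma lieDeriv_apply (ξ : VectorField n X) (f : SmoothFun n X) (x : X) :
    lieDeriv ξ f x = mfderiv (𝓡 n) 𝓘(ℝ, ℂ) f x (ξ x) := rfl

lemma lieDeriv_mul (ξ : VectorField n X) (f g : SmoothFun n X) :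
    lieDeriv ξ (f * g) = f * lieDeriv ξ g + lieDeriv ξ f * g := by
  ext x
  have h := (f.mdifferentiableAt (x := x)).hasMFDerivAt.mul' g.mdifferentiableAt.hasMFDerivAt
  change mfderiv (𝓡 n) 𝓘(ℝ, ℂ) (⇑f * ⇑g) x (ξ x) = _
  rw [h.mfderiv]
  rfl

lemma lieDeriv_eventuallyEq (ξ : VectorField n X) {f g : SmoothFun n X} {x : X}
    (h : f =ᶠ[𝓝 x] g) : lieDeriv ξ f =ᶠ[𝓝 x] lieDeriv ξ g := by
  filter_upwards [h.eventually_nhds] with y hy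
  rw [lieDeriv_apply, lieDeriv_apply, EventuallyEq.mfderiv_eq hy]
  rfl

lemma iterLieDeriv_eventuallyEq (ξs : List (VectorField n X)) {f g : SmoothFun n X} {x : X}
    (h : f =ᶠ[𝓝 x] g) : iterLieDeriv ξs f =ᶠ[𝓝 x] iterLieDeriv ξs g := by
  induction ξs with
  | nil => exact h
  | cons ξ ξs ih => exact lieDeriv_eventuallyEq ξ ih

lemma iterLieDeriv_append_singleton (ξs : List (VectorField n X)) (ξ : VectorField n X)
    (f : SmoothFun n X) : iterLieDeriv (ξs ++ [ξ]) f = iterLieDeriv ξs (lieDeriv ξ f) := by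
  simp [iterLieDeriv]

lemma supOn_mono {K : Set X} {f g : X → ℂ} (h : ∀ x ∈ K, ‖f x‖ₑ ≤ ‖g x‖ₑ) :
    supOn K f ≤ supOn K g :=
  iSup₂_le fun x hx ↦ (h x hx).trans (le_supOn g hx)

lemma supOn_mul_le (K : Set X) (f g : X → ℂ) : supOn K (f * g) ≤ supOn K f * supOn K g :=
  iSup₂_le fun x hx ↦ by
    rw [Pi.mul_apply, enorm_mul]
    exact mul_le_mul' (le_supOn f hx) (le_supOn g hx)

/-! ### Bounds on the derivatives of bounded order -/

/-- On `K`, the Lie derivatives of order at most `k` of the net `f` are `O(ε ^ b)`. -/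
def IsBigOPowOfOrder (K : Set X) (k : ℕ) (b : ℝ) (f : Eps → SmoothFun n X) : Prop :=
  ∀ ξs : List (VectorField n X), ξs.length ≤ k →
    IsBigOPow (fun ε ↦ supOn K (iterLieDeriv ξs (f ε))) b

namespace IsBigOPowOfOrder

variable {K : Set X} {k : ℕ} {b b' : ℝ} {f g : Eps → SmoothFun n X}

lemma weaken (h : IsBigOPowOfOrder K k b f) (hb : b' ≤ b) : IsBigOPowOfOrder K k b' f :=
  fun ξs hξ ↦ (h ξs hξ).weaken hb

lemma of_le {k' : ℕ} (h : IsBigOPowOfOrder K k b f) (hk : k' ≤ k) : IsBigOPowOfOrder K k' b f :=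
  fun ξs hξ ↦ h ξs (hξ.trans hk)

lemma zero_iff : IsBigOPowOfOrder K 0 b f ↔ IsBigOPow (fun ε ↦ supOn K (f ε)) b := by
  refine ⟨fun h ↦ h [] le_rfl, fun h ξs hξ ↦ ?_⟩
  obtain rfl : ξs = [] := List.length_eq_zero_iff.1 (Nat.le_zero.1 hξ)
  exact h

/-- The innermost derivative is split off, so that inductions on the order can apply the product and
chain rules to the net itself. -/
lemma succ_iff : IsBigOPowOfOrder K (k + 1) b f ↔ IsBigOPow (fun ε ↦ supOn K (f ε)) b ∧
    ∀ ξ, IsBigOPowOfOrder K k b fun ε ↦ lieDeriv ξ (f ε) := by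
  refine ⟨fun h ↦ ⟨h [] (Nat.zero_le _), fun ξ ξs hξ ↦ ?_⟩, fun h ξs hξ ↦ ?_⟩
  · simpa only [iterLieDeriv_append_singleton] using h (ξs ++ [ξ]) (by simpa using hξ)
  · rcases ξs.eq_nil_or_concat with rfl | ⟨ηs, η, rfl⟩
    · exact h.1
    · rw [List.concat_eq_append] at hξ ⊢
      simp only [iterLieDeriv_append_singleton]
      exact h.2 η ηs (by simpa using hξ)

lemma add (hf : IsBigOPowOfOrder K k b f) (hg : IsBigOPowOfOrder K k b g) :
    IsBigOPowOfOrder K k b fun ε ↦ f ε + g ε := fun ξs hξ ↦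
  ((hf ξs hξ).add (hg ξs hξ)).mono_le fun ε ↦ by
    rw [iterLieDeriv_add]
    exact supOn_add_le K _ _

lemma sum {ι : Type*} (s : Finset ι) {f : ι → Eps → SmoothFun n X}
    (h : ∀ i, IsBigOPowOfOrder K k b (f i)) :
    IsBigOPowOfOrder K k b fun ε ↦ ∑ i ∈ s, f i ε := by
  classical
  induction s using Finset.induction_on with
  | empty =>
    intro ξs _
    refine (IsBigOPow.zero b).mono_le fun ε ↦ ?_
    simp only [Finset.sum_empty, iterLieDeriv_zero]
    exact (supOn_zero K).le
  | insert i s hi ih =>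
    simp only [Finset.sum_insert hi]
    exact (h i).add ih

lemma mul (hf : IsBigOPowOfOrder K k b f) (hg : IsBigOPowOfOrder K k b' g) :
    IsBigOPowOfOrder K k (b + b') fun ε ↦ f ε * g ε := by
  have h0 : ∀ {f g : Eps → SmoothFun n X}, IsBigOPow (fun ε ↦ supOn K (f ε)) b →
      IsBigOPow (fun ε ↦ supOn K (g ε)) b' →
      IsBigOPow (fun ε ↦ supOn K (f ε * g ε : SmoothFun n X)) (b + b') := fun h h' ↦
    (h.mul h').mono_le fun ε ↦ supOn_mul_le K _ _
  induction k generalizing f g with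
  | zero =>
    rw [zero_iff] at *
    exact h0 hf hg
  | succ k ih =>
    have hf' := succ_iff.1 hf
    have hg' := succ_iff.1 hg
    refine succ_iff.2 ⟨h0 hf'.1 hg'.1, fun ξ ↦ ?_⟩
    simp only [lieDeriv_mul]
    exact (ih (hf.of_le k.le_succ) (hg'.2 ξ)).add (ih (hf'.2 ξ) (hg.of_le k.le_succ))

/-- Lie derivatives at a point depend only on the germ there. Equality on `K` alone would not
suffice. -/
lemma congr (hf : IsBigOPowOfOrder K k b f)
    (h : ∃ ε₀ > (0 : ℝ), ∀ ε : Eps, (ε : ℝ) < ε₀ → ∀ x ∈ K, g ε =ᶠ[𝓝 x] f ε) :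
    IsBigOPowOfOrder K k b g := fun ξs hξ ↦ by
  obtain ⟨e, he, h⟩ := h
  refine (hf ξs hξ).mono ⟨e, he, fun ε hε ↦ supOn_mono fun x hx ↦ ?_⟩
  rw [(iterLieDeriv_eventuallyEq ξs (h ε hε x hx)).self_of_nhds]

end IsBigOPowOfOrder

lemma exists_isBigOPowOfOrder (u : moderateNets n X) {K : Set X} (hK : IsCompact K) (k : ℕ) :
    ∃ b, IsBigOPowOfOrder K k b u.1 := by
  choose b hb using u.2 K hK
  refine ⟨(Finset.range (k + 1)).inf' ⟨0, by simp⟩ b, fun ξs hξ ↦ ?_⟩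
  exact (hb _ ξs rfl).weaken (Finset.inf'_le _ (by simpa [Nat.lt_succ_iff] using hξ))

lemma mem_moderateNets {u : Eps → SmoothFun n X}
    (h : ∀ K : Set X, IsCompact K → ∀ k, ∃ b, IsBigOPowOfOrder K k b u) : u ∈ moderateNets n X :=
  fun K hK k ↦ (h K hK k).imp fun _ hb ξs hξ ↦ hb ξs hξ.le

/-! ### Composition with smooth functions -/

/-- The real part of a smooth function. -/
noncomputable def rePart (f : SmoothFun n X) : SmoothFun n X where
  val x := ((f x).re : ℂ)
  property := (Complex.ofRealCLM.comp Complex.reCLM).contMDiff.comp f.contMDiff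

lemma lieDeriv_rePart (ξ : VectorField n X) (f : SmoothFun n X) :
    lieDeriv ξ (rePart f) = rePart (lieDeriv ξ f) := by
  ext x
  have h := ((Complex.ofRealCLM.comp Complex.reCLM).hasMFDerivAt (x := f x)).comp x
    (f.mdifferentiableAt (x := x)).hasMFDerivAt
  change mfderiv (𝓡 n) 𝓘(ℝ, ℂ) (⇑(Complex.ofRealCLM.comp Complex.reCLM) ∘ ⇑f) x (ξ x) = _
  rw [h.mfderiv]
  rfl

lemma iterLieDeriv_rePart (ξs : List (VectorField n X)) (f : SmoothFun n X) :
    iterLieDeriv ξs (rePart f) = rePart (iterLieDeriv ξs f) := by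
  induction ξs with
  | nil => rfl
  | cons ξ ξs ih =>
    change lieDeriv ξ (iterLieDeriv ξs (rePart f)) = _
    rw [ih, lieDeriv_rePart]
    rfl

lemma IsBigOPowOfOrder.rePart {K : Set X} {k : ℕ} {b : ℝ} {f : Eps → SmoothFun n X}
    (hf : IsBigOPowOfOrder K k b f) : IsBigOPowOfOrder K k b fun ε ↦ rePart (f ε) := fun ξs hξ ↦
  (hf ξs hξ).mono_le fun ε ↦ by
    rw [iterLieDeriv_rePart]
    refine supOn_mono fun x _ ↦ ?_
    rw [← ofReal_norm, ← ofReal_norm]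
    refine ENNReal.ofReal_le_ofReal ?_
    change ‖(((iterLieDeriv ξs (f ε) x).re : ℝ) : ℂ)‖ ≤ _
    rw [Complex.norm_real]
    exact Complex.abs_re_le_norm _

variable {m : ℕ}

/-- The real part of a vector of smooth functions, as a map into Euclidean space. -/
noncomputable def realVec (U : Fin m → SmoothFun n X) (x : X) : EuclideanSpace ℝ (Fin m) :=
  WithLp.toLp 2 fun j ↦ (U j x).re

lemma hasMFDerivAt_realVec (U : Fin m → SmoothFun n X) (x : X) :
    HasMFDerivAt (𝓡 n) (𝓡 m) (realVec U) x
      ((PiLp.continuousLinearEquiv 2 ℝ fun _ : Fin m ↦ ℝ).symm.toContinuousLinearMap.comp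
        (ContinuousLinearMap.pi fun j ↦
          Complex.reCLM.comp (mfderiv (𝓡 n) 𝓘(ℝ, ℂ) (U j) x))) := by
  have h1 : HasMFDerivAt (𝓡 n) 𝓘(ℝ, Fin m → ℝ) (fun x j ↦ (U j x).re) x
      (ContinuousLinearMap.pi fun j ↦ Complex.reCLM.comp (mfderiv (𝓡 n) 𝓘(ℝ, ℂ) (U j) x)) := by
    refine ⟨continuousAt_pi.2 fun j ↦
      (Complex.continuous_re.comp (U j).contMDiff.continuous).continuousAt, ?_⟩
    exact hasFDerivWithinAt_pi.2 fun j ↦ ((Complex.reCLM.hasMFDerivAt (x := U j x)).comp x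
      ((U j).mdifferentiableAt (x := x)).hasMFDerivAt).2
  exact ((PiLp.continuousLinearEquiv 2 ℝ fun _ : Fin m ↦ ℝ).symm.toContinuousLinearMap.hasMFDerivAt
    (x := fun j ↦ (U j x).re)).comp x h1

lemma contMDiff_realVec (U : Fin m → SmoothFun n X) : ContMDiff (𝓡 n) (𝓡 m) ∞ (realVec U) := by
  have h1 : ContMDiff (𝓡 n) 𝓘(ℝ, Fin m → ℝ) ∞ (fun x j ↦ (U j x).re) :=
    contMDiff_pi_space.2 fun j ↦ Complex.reCLM.contMDiff.comp (U j).contMDiff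
  exact (PiLp.continuousLinearEquiv 2 ℝ fun _ : Fin m ↦ ℝ).symm.toContinuousLinearMap.contMDiff.comp h1

/-- The composition of a smooth function with the real part of a vector of smooth functions. -/
noncomputable def compRealVec (g : EuclideanSpace ℝ (Fin m) → ℂ) (hg : ContDiff ℝ ∞ g)
    (U : Fin m → SmoothFun n X) : SmoothFun n X where
  val x := g (realVec U x)
  property := hg.contMDiff.comp (contMDiff_realVec U)

/-- The `j`-th partial derivative. -/
noncomputable def partialDeriv (j : Fin m) (g : EuclideanSpace ℝ (Fin m) → ℂ) (y : EuclideanSpace ℝ (Fin m)) :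
    ℂ :=
  fderiv ℝ g y (EuclideanSpace.single j 1)

lemma contDiff_partialDeriv (j : Fin m) {g : EuclideanSpace ℝ (Fin m) → ℂ} (hg : ContDiff ℝ ∞ g) :
    ContDiff ℝ ∞ (partialDeriv j g) :=
  (hg.fderiv_right (m := ∞) (by simp)).clm_apply contDiff_const

lemma hasCompactSupport_partialDeriv (j : Fin m) {g : EuclideanSpace ℝ (Fin m) → ℂ}
    (hg : HasCompactSupport g) : HasCompactSupport (partialDeriv j g) :=
  hg.fderiv_apply (𝕜 := ℝ) _

lemma lieDeriv_compRealVec (ξ : VectorField n X) {g : EuclideanSpace ℝ (Fin m) → ℂ}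
    (hg : ContDiff ℝ ∞ g) (U : Fin m → SmoothFun n X) :
    lieDeriv ξ (compRealVec g hg U) = ∑ j,
      compRealVec (partialDeriv j g) (contDiff_partialDeriv j hg) U *
        rePart (lieDeriv ξ (U j)) := by
  ext x
  have h := ((hg.differentiable (by simp)) (realVec U x)).hasFDerivAt.hasMFDerivAt.comp x
    (hasMFDerivAt_realVec U x)
  have hsum : (⇑(∑ j, compRealVec (partialDeriv j g) (contDiff_partialDeriv j hg) U *
        rePart (lieDeriv ξ (U j))) : X → ℂ) = ∑ j,
        ⇑(compRealVec (partialDeriv j g) (contDiff_partialDeriv j hg) U *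
        rePart (lieDeriv ξ (U j))) := map_sum ContMDiffMap.coeFnAddMonoidHom _ _
  rw [hsum, Finset.sum_apply]
  change mfderiv (𝓡 n) 𝓘(ℝ, ℂ) (g ∘ realVec U) x (ξ x) = _
  rw [h.mfderiv]
  let w : EuclideanSpace ℝ (Fin m) := WithLp.toLp 2 fun j ↦ (lieDeriv ξ (U j) x).re
  change fderiv ℝ g (realVec U x) w = ∑ j, fderiv ℝ g (realVec U x) (EuclideanSpace.single j 1) *
    (((lieDeriv ξ (U j) x).re : ℝ) : ℂ)
  have hw : w = ∑ j, (lieDeriv ξ (U j) x).re • EuclideanSpace.single j (1 : ℝ) := by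
    ext i
    simp [w, Finset.sum_apply, Pi.single_apply]
  rw [hw, map_sum]
  refine Finset.sum_congr rfl fun j _ ↦ ?_
  rw [map_smul, Complex.real_smul, mul_comm]

/-- Composition with a smooth function of compact support preserves moderate bounds. -/
lemma exists_isBigOPowOfOrder_compRealVec (K : Set X) (k : ℕ) (b : ℝ) :
    ∃ b' : ℝ, ∀ U : Fin m → Eps → SmoothFun n X, (∀ j, IsBigOPowOfOrder K k b (U j)) →
      ∀ (g : EuclideanSpace ℝ (Fin m) → ℂ) (hg : ContDiff ℝ ∞ g), HasCompactSupport g →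
        IsBigOPowOfOrder K k b' fun ε ↦ compRealVec g hg fun j ↦ U j ε := by
  have h0 : ∀ (U : Fin m → Eps → SmoothFun n X) (g : EuclideanSpace ℝ (Fin m) → ℂ)
      (hg : ContDiff ℝ ∞ g), HasCompactSupport g →
      IsBigOPow (fun ε ↦ supOn K (compRealVec g hg fun j ↦ U j ε)) 0 := by
    intro U g hg hgc
    obtain ⟨C, hC⟩ := hgc.exists_bound_of_continuous hg.continuous
    refine ⟨C.toNNReal, 1, one_pos, fun ε _ ↦ iSup₂_le fun x _ ↦ ?_⟩
    rw [Real.rpow_zero, ENNReal.ofReal_one, mul_one, ← ofReal_norm]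
    exact ENNReal.ofReal_le_ofReal (hC _)
  induction k with
  | zero => exact ⟨0, fun U _ g hg hgc ↦ IsBigOPowOfOrder.zero_iff.2 (h0 U g hg hgc)⟩
  | succ k ih =>
    -- The exponent is chosen before `g`, so the same `b'` serves all partial derivatives of `g`,
    -- which again have compact support.
    obtain ⟨b', hb'⟩ := ih
    refine ⟨min 0 (b' + b), fun U hU g hg hgc ↦ IsBigOPowOfOrder.succ_iff.2
      ⟨(h0 U g hg hgc).weaken (min_le_left _ _), fun ξ ↦ ?_⟩⟩
    simp only [lieDeriv_compRealVec]
    refine (IsBigOPowOfOrder.sum _ fun j ↦ ?_).weaken (min_le_right _ _)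
    exact (hb' U (fun j ↦ (hU j).of_le k.le_succ) _ _
      (hasCompactSupport_partialDeriv j hgc)).mul
        ((IsBigOPowOfOrder.succ_iff.1 (hU j)).2 ξ).rePart

end Manifold

/-! ### Small indices -/

/-- The filter of neighborhoods of `0` in the index set. -/
def smallEps : Filter Eps := comap (↑) (𝓝 (0 : ℝ))

lemma eventually_smallEps_iff {P : Eps → Prop} :
    (∀ᶠ ε in smallEps, P ε) ↔ ∃ ε₀ > (0 : ℝ), ∀ ε : Eps, (ε : ℝ) < ε₀ → P ε := by
  rw [smallEps, (Metric.nhds_basis_ball.comap _).eventually_iff]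
  refine exists_congr fun e ↦ and_congr_right fun _ ↦ forall_congr' fun ε ↦ ?_
  simp [abs_of_pos ε.2.1]

lemma tendsto_smallEps : Tendsto (fun ε : Eps ↦ (ε : ℝ)) smallEps (𝓝 0) := tendsto_comap

instance : NeBot smallEps := by
  refine comap_neBot fun s hs ↦ ?_
  obtain ⟨e, he, h⟩ := Metric.mem_nhds_iff.1 hs
  have h1 : (0 : ℝ) < min e 1 / 2 := by positivity
  have h2 := min_le_left e 1
  have h3 := min_le_right e 1
  refine ⟨⟨min e 1 / 2, h1, by linarith⟩, h ?_⟩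
  rw [Metric.mem_ball, dist_zero_right, Real.norm_of_nonneg h1.le]
  linarith

lemma IsBigOPow.of_eventually {a a' : Eps → ℝ≥0∞} {b : ℝ} (h : IsBigOPow a b)
    (hle : ∀ᶠ ε in smallEps, a' ε ≤ a ε) : IsBigOPow a' b :=
  h.mono (eventually_smallEps_iff.1 hle)

lemma IsNegligible.of_eventually {a a' : Eps → ℝ≥0∞} (h : IsNegligible a)
    (hle : ∀ᶠ ε in smallEps, a' ε ≤ a ε) : IsNegligible a' :=
  fun b ↦ (h b).of_eventually hle

lemma IsNegligible.mono {a a' : Eps → ℝ≥0∞} (h : IsNegligible a)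
    (hle : ∀ ε, a' ε ≤ a ε) : IsNegligible a' :=
  fun b ↦ (h b).mono_le hle

lemma isNegligible_zero : IsNegligible fun _ ↦ 0 := IsBigOPow.zero

lemma isNegligible_iff_nat {a : Eps → ℝ≥0∞} : IsNegligible a ↔ ∀ k : ℕ, IsBigOPow a k := by
  refine ⟨fun h k ↦ h k, fun h b ↦ ?_⟩
  obtain ⟨k, hk⟩ := exists_nat_ge b
  exact (h k).weaken hk

lemma IsNegligible.sum {ι : Type*} (s : Finset ι) {a : ι → Eps → ℝ≥0∞}
    (h : ∀ i, IsNegligible (a i)) : IsNegligible fun ε ↦ ∑ i ∈ s, a i ε := by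
  classical
  induction s using Finset.induction_on with
  | empty => simpa using isNegligible_zero
  | insert i s hi ih =>
    simp only [Finset.sum_insert hi]
    exact (h i).add ih

lemma IsNegligible.const_mul {a : Eps → ℝ≥0∞} (h : IsNegligible a) (C : ℝ≥0) :
    IsNegligible fun ε ↦ C * a ε := fun b ↦ by
  have h0 : IsBigOPow (fun _ ↦ (C : ℝ≥0∞)) 0 := ⟨C, 1, one_pos, fun ε _ ↦ by simp⟩
  simpa using h0.mul (h b)

lemma eventually_mul_smallEps_lt_one (C : ℝ) : ∀ᶠ ε : Eps in smallEps, C * (ε : ℝ) < 1 := by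
  have := tendsto_smallEps.const_mul C
  rw [mul_zero] at this
  exact this.eventually_lt_const one_pos

lemma IsNegligible.eventually_le {a : Eps → ℝ≥0∞} (h : IsNegligible a) :
    ∀ᶠ ε in smallEps, a ε ≤ ENNReal.ofReal (ε : ℝ) := by
  -- The exponent `2` leaves a spare factor `ε` that absorbs the constant `C`.
  obtain ⟨C, e, he, hC⟩ := h 2
  filter_upwards [eventually_mul_smallEps_lt_one C, eventually_smallEps_iff.2 ⟨e, he, hC⟩] with ε hε hle
  refine hle.trans ?_
  rw [← ENNReal.ofReal_coe_nnreal, ← ENNReal.ofReal_mul C.coe_nonneg]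
  refine ENNReal.ofReal_le_ofReal ?_
  have h0 := ε.2.1
  rw [Real.rpow_two, sq, ← mul_assoc]
  nlinarith

lemma eventually_smallEps_lt {δ : ℝ} (hδ : 0 < δ) : ∀ᶠ ε : Eps in smallEps, (ε : ℝ) < δ :=
  tendsto_smallEps.eventually_lt_const hδ

/-! ### Real and complex vectors -/

section Vectors

variable {m : ℕ}

lemma edist_le_sum_enorm_sub (z w : EuclideanSpace ℂ (Fin m)) :
    edist z w ≤ ∑ j, ‖z j - w j‖ₑ := by
  have h : z - w = ∑ j, EuclideanSpace.single j ((z - w) j) := by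
    ext i
    simp [Finset.sum_apply, Pi.single_apply]
  rw [edist_eq_enorm_sub, h]
  refine (enorm_sum_le _ _).trans (Finset.sum_le_sum fun j _ ↦ ?_)
  rw [← ofReal_norm, PiLp.norm_single, ofReal_norm]
  rfl

lemma enorm_sub_le_edist (z w : EuclideanSpace ℂ (Fin m)) (j : Fin m) :
    ‖z j - w j‖ₑ ≤ edist z w := by
  rw [edist_eq_enorm_sub, ← ofReal_norm, ← ofReal_norm]
  exact ENNReal.ofReal_le_ofReal (PiLp.norm_apply_le (z - w) j)

lemma isometry_toComplex :
    Isometry (toComplex : EuclideanSpace ℝ (Fin m) → EuclideanSpace ℂ (Fin m)) := by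
  refine Isometry.of_dist_eq fun y y' ↦ ?_
  rw [EuclideanSpace.dist_eq, EuclideanSpace.dist_eq]
  congr 1
  refine Finset.sum_congr rfl fun j _ ↦ ?_
  change dist ((y j : ℝ) : ℂ) ((y' j : ℝ) : ℂ) ^ 2 = _
  rw [Complex.isometry_ofReal.dist_eq]

lemma isometry_toComplex_coe {Y : Set (EuclideanSpace ℝ (Fin m))} :
    Isometry fun y : Y ↦ toComplex (y : EuclideanSpace ℝ (Fin m)) :=
  isometry_toComplex.comp isometry_subtype_coe

lemma isCompact_complexSet {Y : Set (EuclideanSpace ℝ (Fin m))} {K' : Set Y}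
    (hK' : IsCompact K') : IsCompact (complexSet K') :=
  hK'.image isometry_toComplex_coe.continuous

lemma nonempty_of_infEDist_le_ofReal {α : Type*} [PseudoEMetricSpace α] {x : α} {s : Set α} {r : ℝ}
    (h : Metric.infEDist x s ≤ ENNReal.ofReal r) : s.Nonempty := by
  by_contra hs
  rw [not_nonempty_iff_eq_empty.1 hs, Metric.infEDist_empty, top_le_iff] at h
  exact ENNReal.ofReal_ne_top h

end Vectors

section Manifold

variable {d n m : ℕ} {X : Set (EuclideanSpace ℝ (Fin d))}
  [ChartedSpace (EuclideanSpace ℝ (Fin n)) X] [IsManifold (𝓡 n) ∞ X]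

/-- Representatives are complex-valued while the retraction lives on real vectors; taking real parts
does not increase the distance to a real vector. -/
lemma edist_realVec_le (U : Fin m → moderateNets n X) (ε : Eps) (x : X)
    (y : EuclideanSpace ℝ (Fin m)) :
    edist (realVec (fun j ↦ (U j).1 ε) x) y ≤ edist (netValue U ε x) (toComplex y) := by
  rw [edist_dist, edist_dist]
  refine ENNReal.ofReal_le_ofReal ?_
  rw [EuclideanSpace.dist_eq, EuclideanSpace.dist_eq]
  refine Real.sqrt_le_sqrt (Finset.sum_le_sum fun j _ ↦ ?_)
  change dist ((U j).1 ε x).re (y j) ^ 2 ≤ dist ((U j).1 ε x) (y j : ℂ) ^ 2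
  gcongr
  rw [Real.dist_eq, Complex.dist_eq]
  simpa using Complex.abs_re_le_norm ((U j).1 ε x - (y j : ℂ))

lemma continuous_netValue (U : Fin m → moderateNets n X) (ε : Eps) :
    Continuous (netValue U ε) :=
  (PiLp.continuous_toLp 2 _).comp (continuous_pi fun j ↦ ((U j).1 ε).contMDiff.continuous)

/-! ### Representatives -/

lemma exists_isRepresentative (u : Fin m → GenFun n X) :
    ∃ U : Fin m → moderateNets n X, IsRepresentative U u := by
  choose U hU using fun j ↦ QuotientAddGroup.mk_surjective (u j)
  exact ⟨U, hU⟩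

/-- The Euclidean distance dominates each component and is at most their sum. No derivatives enter,
because `negligibleNets` constrains only the values. -/
lemma IsRepresentative.iff_isNegligible {U V : Fin m → moderateNets n X}
    {u : Fin m → GenFun n X} (hU : IsRepresentative U u) :
    IsRepresentative V u ↔ ∀ K : Set X, IsCompact K →
      IsNegligible fun ε ↦ ⨆ x ∈ K, edist (netValue V ε x) (netValue U ε x) := by
  have h : IsRepresentative V u ↔ ∀ j, V j - U j ∈ negligibleNets n X :=
    forall_congr' fun j ↦ by rw [← hU j, QuotientAddGroup.eq_iff_sub_mem]
  rw [h]
  refine ⟨fun h K hK ↦ ?_, fun h j K hK ↦ (h K hK).mono fun ε ↦ iSup₂_mono fun x _ ↦ ?_⟩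
  · refine (IsNegligible.sum Finset.univ fun j ↦ h j K hK).mono fun ε ↦ iSup₂_le fun x hx ↦ ?_
    refine (edist_le_sum_enorm_sub _ _).trans (Finset.sum_le_sum fun j _ ↦ ?_)
    exact le_supOn (K := K) ((V j - U j).1 ε) hx
  · exact enorm_sub_le_edist (netValue V ε x) (netValue U ε x) j

variable {n' : ℕ} {Y : Set (EuclideanSpace ℝ (Fin m))}
  [ChartedSpace (EuclideanSpace ℝ (Fin n')) Y] [IsManifold (𝓡 n') ∞ Y]

lemma pointValue_eq_pointCoords_iff (hX : IsEmbeddedSubmanifold n X)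
    (hY : IsEmbeddedSubmanifold n' Y) {U : Fin m → moderateNets n X} {u : Fin m → GenFun n X}
    (hU : IsRepresentative U u) (p : CompactNet X) (q : CompactNet Y) :
    (fun j ↦ pointValue hX (u j) (Quotient.mk (pointSetoid n X) p)) =
        pointCoords hY (Quotient.mk (pointSetoid n' Y) q) ↔
      IsNegligible fun ε ↦ edist (netValue U ε (p.1 ε))
        (toComplex (q.1 ε : EuclideanSpace ℝ (Fin m))) := by
  have h : (fun j ↦ pointValue hX (u j) (Quotient.mk (pointSetoid n X) p)) =
        pointCoords hY (Quotient.mk (pointSetoid n' Y) q) ↔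
      ∀ j, evalNet p (U j) - coordNet q j ∈ negligibleNumbers := by
    rw [funext_iff]
    refine forall_congr' fun j ↦ ?_
    rw [← hU j, ← QuotientAddGroup.eq_iff_sub_mem]
    rfl
  rw [h]
  refine ⟨fun h ↦ ?_, fun h j ↦ h.mono fun ε ↦ ?_⟩
  · refine (IsNegligible.sum Finset.univ h).mono fun ε ↦ ?_
    exact edist_le_sum_enorm_sub _ _
  · exact enorm_sub_le_edist (netValue U ε (p.1 ε))
      (toComplex (q.1 ε : EuclideanSpace ℝ (Fin m))) j

/-! ### The implications between the characterizations -/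

lemma isNegligiblyCloseTo_iff {U : Fin m → moderateNets n X} :
    IsNegligiblyCloseTo U Y ↔ ∀ K : Set X, IsCompact K → ∃ K' : Set Y, IsCompact K' ∧
      IsNegligible fun ε ↦ ⨆ x ∈ K, Metric.infEDist (netValue U ε x) (complexSet K') := by
  simp only [isNegligible_iff_nat]
  rfl

lemma IsCBounded.exists_isNegligiblyCloseTo {u : Fin m → GenFun n X} (h : IsCBounded u Y) :
    ∃ U : Fin m → moderateNets n X, IsRepresentative U u ∧ IsNegligiblyCloseTo U Y := by
  obtain ⟨U, hU, h⟩ := h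
  refine ⟨U, hU, isNegligiblyCloseTo_iff.2 fun K hK ↦ ?_⟩
  obtain ⟨K', hK', e, he, h⟩ := h K hK
  refine ⟨K', hK', isNegligible_zero.of_eventually ?_⟩
  filter_upwards [eventually_smallEps_lt he] with ε hε
  exact iSup₂_le fun x hx ↦ (Metric.infEDist_zero_of_mem (h ε hε.le hx)).le

/-- The same `K'` works for both representatives, by the triangle inequality. -/
lemma IsNegligiblyCloseTo.congr {U V : Fin m → moderateNets n X} {u : Fin m → GenFun n X}
    (h : IsNegligiblyCloseTo U Y) (hU : IsRepresentative U u) (hV : IsRepresentative V u) :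
    IsNegligiblyCloseTo V Y := by
  rw [isNegligiblyCloseTo_iff] at *
  intro K hK
  obtain ⟨K', hK', h⟩ := h K hK
  refine ⟨K', hK', (h.add (hU.iff_isNegligible.1 hV K hK)).mono fun ε ↦ iSup₂_le fun x hx ↦ ?_⟩
  refine (Metric.infEDist_le_infEDist_add_edist (y := netValue U ε x)).trans (add_le_add ?_ ?_)
  · exact le_iSup₂ (f := fun x (_ : x ∈ K) ↦ Metric.infEDist (netValue U ε x) (complexSet K')) x hx
  · exact le_iSup₂ (f := fun x (_ : x ∈ K) ↦ edist (netValue V ε x) (netValue U ε x)) x hx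

lemma IsNegligiblyCloseTo.exists_compactNet {U : Fin m → moderateNets n X}
    (h : IsNegligiblyCloseTo U Y) (p : CompactNet X) :
    ∃ q : CompactNet Y, IsNegligible fun ε ↦ edist (netValue U ε (p.1 ε))
        (toComplex (q.1 ε : EuclideanSpace ℝ (Fin m))) := by
  obtain ⟨K, hK, hp⟩ := p.2
  replace hp := eventually_smallEps_iff.2 hp
  obtain ⟨K', hK', h⟩ := isNegligiblyCloseTo_iff.1 h K hK
  have h' : IsNegligible fun ε ↦ Metric.infEDist (netValue U ε (p.1 ε)) (complexSet K') := by
    refine h.of_eventually ?_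
    filter_upwards [hp] with ε hε
    exact le_iSup₂ (f := fun x (_ : x ∈ K) ↦ Metric.infEDist (netValue U ε x) (complexSet K')) _ hε
  -- A single finite distance shows that `K'` is nonempty, since the distance to the empty set is
  -- `∞`.
  obtain ⟨ε₀, hε₀⟩ := h'.eventually_le.exists
  have hne := nonempty_of_infEDist_le_ofReal hε₀
  have hq : ∀ ε : Eps, ∃ y ∈ K', Metric.infEDist (netValue U ε (p.1 ε)) (complexSet K') =
      edist (netValue U ε (p.1 ε)) (toComplex (y : EuclideanSpace ℝ (Fin m))) := by
    intro ε
    obtain ⟨_, ⟨y, hy, rfl⟩, h⟩ :=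
      (isCompact_complexSet hK').exists_infEDist_eq_edist hne (netValue U ε (p.1 ε))
    exact ⟨y, hy, h⟩
  choose q hqK hq using hq
  exact ⟨⟨q, K', hK', 1, one_pos, fun ε _ ↦ hqK ε⟩, h'.mono fun ε ↦ (hq ε).ge⟩

/-- If the values of `U` at compactly supported points are compactly supported points of `Y`,
then `U` maps a compact set into the `ε`-neighborhood of a compact subset of `Y`. -/
lemma exists_eventually_infEDist_le {U : Fin m → moderateNets n X}
    (h : ∀ p : CompactNet X, ∃ q : CompactNet Y, IsNegligible fun ε ↦
      edist (netValue U ε (p.1 ε)) (toComplex (q.1 ε : EuclideanSpace ℝ (Fin m))))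
    (E : CompactExhaustion Y) {K : Set X} (hK : IsCompact K) (hne : K.Nonempty) :
    ∃ l, ∀ᶠ ε in smallEps, ∀ x ∈ K,
      Metric.infEDist (netValue U ε x) (complexSet (E l)) ≤ ENNReal.ofReal (ε : ℝ) := by
  -- If the bound by `ε` on `K` fails for some `E l` with `l < N`, then `x₀` is a point violating it
  -- for the largest such `l`. It then violates the bound for all smaller `l` too, while for larger
  -- ones the bound holds on all of `K`.
  have key : ∀ (ε : Eps) (N : ℕ), ∃ x₀ ∈ K, ∀ l < N,
      Metric.infEDist (netValue U ε x₀) (complexSet (E l)) ≤ ENNReal.ofReal (ε : ℝ) →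
      ∀ x ∈ K, Metric.infEDist (netValue U ε x) (complexSet (E l)) ≤ ENNReal.ofReal (ε : ℝ) := by
    intro ε N
    induction N with
    | zero =>
      obtain ⟨x, hx⟩ := hne
      exact ⟨x, hx, fun l hl ↦ (Nat.not_lt_zero l hl).elim⟩
    | succ N ih =>
      by_cases hN : ∀ x ∈ K,
        Metric.infEDist (netValue U ε x) (complexSet (E N)) ≤ ENNReal.ofReal (ε : ℝ)
      · obtain ⟨x₀, hx₀, h⟩ := ih
        refine ⟨x₀, hx₀, fun l hl hle ↦ ?_⟩
        rcases Nat.lt_succ_iff_lt_or_eq.1 hl with hl | rfl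
        · exact h l hl hle
        · exact hN
      · push Not at hN
        obtain ⟨x₀, hx₀, hlt⟩ := hN
        refine ⟨x₀, hx₀, fun l hl hle ↦ (hlt.not_ge (le_trans ?_ hle)).elim⟩
        exact Metric.infEDist_anti (image_mono (E.subset (Nat.lt_succ_iff.1 hl)))
  -- The range of tested indices grows like `1 / ε`, so each fixed `l` is tested once `l * ε < 1`.
  choose p hpK hp using fun ε : Eps ↦ key ε ⌈(ε : ℝ)⁻¹⌉₊
  obtain ⟨q, hq⟩ := h ⟨p, K, hK, 1, one_pos, fun ε _ ↦ hpK ε⟩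
  obtain ⟨Q, hQ, hqQ⟩ := q.2
  obtain ⟨l, hl⟩ := E.exists_superset_of_isCompact hQ
  refine ⟨l, ?_⟩
  filter_upwards [hq.eventually_le, eventually_smallEps_iff.2 hqQ,
    eventually_mul_smallEps_lt_one l] with ε h1 h2 h3
  refine hp ε l ?_ ((Metric.infEDist_le_edist_of_mem (mem_image_of_mem _ (hl h2))).trans h1)
  rw [Nat.lt_ceil]
  rwa [← lt_div_iff₀ ε.2.1, one_div] at h3

/-- The supremum over `K` is attained at some `p ε`, so it is bounded by the negligible distance
from the value there to `q ε`, provided `q ε` lies in the chosen compact set. -/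
lemma isNegligiblyCloseTo_of_forall_compactNet [LocallyCompactSpace Y]
    {U : Fin m → moderateNets n X}
    (h : ∀ p : CompactNet X, ∃ q : CompactNet Y, IsNegligible fun ε ↦
      edist (netValue U ε (p.1 ε)) (toComplex (q.1 ε : EuclideanSpace ℝ (Fin m)))) :
    IsNegligiblyCloseTo U Y := by
  rw [isNegligiblyCloseTo_iff]
  intro K hK
  rcases K.eq_empty_or_nonempty with rfl | hne
  · exact ⟨∅, isCompact_empty, by simpa using isNegligible_zero⟩
  let E := CompactExhaustion.choice Y
  obtain ⟨l, hl⟩ := exists_eventually_infEDist_le h E hK hne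
  -- The points `q ε` are only known to be within `2 * ε` of `E l`; for small `ε` this places them
  -- in `E (l + 1)`, whose interior contains `E l`.
  refine ⟨E (l + 1), E.isCompact _, ?_⟩
  obtain ⟨δ, hδ, hthick⟩ :=
    (E.isCompact l).exists_thickening_subset_open isOpen_interior (E.subset_interior_succ l)
  have hmax : ∀ ε, ∃ x₀ ∈ K, ∀ x ∈ K, Metric.infEDist (netValue U ε x) (complexSet (E (l + 1))) ≤
      Metric.infEDist (netValue U ε x₀) (complexSet (E (l + 1))) := fun ε ↦
    hK.exists_isMaxOn hne
      (Metric.continuous_infEDist.comp (continuous_netValue U ε)).continuousOn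
  choose p hpK hp using hmax
  obtain ⟨q, hq⟩ := h ⟨p, K, hK, 1, one_pos, fun ε _ ↦ hpK ε⟩
  refine hq.of_eventually ?_
  filter_upwards [hq.eventually_le, hl, eventually_smallEps_lt (half_pos hδ)] with ε h1 h2 h3
  refine iSup₂_le fun x hx ↦ (hp ε x hx).trans ?_
  refine Metric.infEDist_le_edist_of_mem (mem_image_of_mem _ (interior_subset (hthick ?_)))
  rw [Metric.mem_thickening_iff_infEDist_lt, ← Metric.infEDist_image isometry_toComplex_coe]
  calc Metric.infEDist (toComplex (q.1 ε : EuclideanSpace ℝ (Fin m))) (complexSet (E l))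
      ≤ Metric.infEDist (netValue U ε (p ε)) (complexSet (E l)) +
          edist (toComplex (q.1 ε : EuclideanSpace ℝ (Fin m))) (netValue U ε (p ε)) :=
        Metric.infEDist_le_infEDist_add_edist
    _ ≤ ENNReal.ofReal (ε : ℝ) + ENNReal.ofReal (ε : ℝ) := by
        rw [edist_comm (toComplex _)]
        exact add_le_add (h2 _ (hpK ε)) h1
    _ < ENNReal.ofReal δ := by
        rw [← ENNReal.ofReal_add ε.2.1.le ε.2.1.le]
        exact (ENNReal.ofReal_lt_ofReal_iff hδ).2 (by linarith)

end Manifold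

/-! ### Moving a net into the submanifold -/

section Manifold

variable {d n m : ℕ} {X : Set (EuclideanSpace ℝ (Fin d))}
  [ChartedSpace (EuclideanSpace ℝ (Fin n)) X] [IsManifold (𝓡 n) ∞ X]

/-- The `j`-th coordinate of a map into Euclidean space, with complex values. -/
def complexCoord {M : Type*} (g : M → EuclideanSpace ℝ (Fin m)) (j : Fin m) (y : M) : ℂ :=
  ((g y j : ℝ) : ℂ)

lemma contDiff_complexCoord {g : EuclideanSpace ℝ (Fin m) → EuclideanSpace ℝ (Fin m)}
    (hg : ContDiff ℝ ∞ g) (j : Fin m) : ContDiff ℝ ∞ (complexCoord g j) :=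
  (Complex.ofRealCLM.comp (EuclideanSpace.proj (𝕜 := ℝ) j)).contDiff.comp hg

lemma hasCompactSupport_complexCoord {M : Type*} [TopologicalSpace M]
    {g : M → EuclideanSpace ℝ (Fin m)} (hg : HasCompactSupport g) (j : Fin m) :
    HasCompactSupport (complexCoord g j) :=
  hg.comp_left (g := fun y : EuclideanSpace ℝ (Fin m) ↦ ((y j : ℝ) : ℂ)) (by simp)

/-- A map given on an increasing sequence of compact sets, near finitely many of which it is
smooth, agrees on those with a smooth map. -/
lemma exists_contMDiff_eqOn_of_lt (E : CompactExhaustion X) {Ω : Set X} (hΩ : IsOpen Ω)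
    {F : Type*} [NormedAddCommGroup F] [NormedSpace ℝ F] {h : X → F}
    (hh : ContMDiffOn (𝓡 n) 𝓘(ℝ, F) ∞ h Ω) (N : ℕ) :
    ∃ f : X → F, ContMDiff (𝓡 n) 𝓘(ℝ, F) ∞ f ∧ ∀ l < N, E l ⊆ Ω → EqOn f h (E l) := by
  have : LocallyCompactSpace X := ChartedSpace.locallyCompactSpace (EuclideanSpace ℝ (Fin n)) X
  induction N with
  | zero => exact ⟨0, contMDiff_const, fun l hl ↦ (Nat.not_lt_zero l hl).elim⟩
  | succ N ih =>
    -- Only the largest member contained in `Ω` matters: agreement there includes the smaller ones,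
    -- and members not contained in `Ω` impose nothing.
    by_cases hN : E N ⊆ Ω
    · obtain ⟨f, hf, -, hfh⟩ := exists_contMDiff_eqOn_of_isCompact (E.isCompact N) hΩ hN hh
      exact ⟨f, hf, fun l hl _ ↦ hfh.mono (E.subset (Nat.lt_succ_iff.1 hl))⟩
    · obtain ⟨f, hf, hfh⟩ := ih
      refine ⟨f, hf, fun l hl hlΩ ↦ ?_⟩
      rcases Nat.lt_succ_iff_lt_or_eq.1 hl with hl | rfl
      · exact hfh l hl hlΩ
      · exact (hN hlΩ).elim

variable {Y : Set (EuclideanSpace ℝ (Fin m))}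

/-- Applying to a net that is negligibly close to `Y` a smooth map that is defined near `Y`: there
is a net of smooth functions which, on a given compact set and for small `ε`, is the composition
with a compactly supported smooth map. -/
lemma IsNegligiblyCloseTo.exists_comp {U : Fin m → moderateNets n X}
    (h : IsNegligiblyCloseTo U Y)
    {π : EuclideanSpace ℝ (Fin m) → EuclideanSpace ℝ (Fin m)} {T : Set (EuclideanSpace ℝ (Fin m))}
    (hT : IsOpen T) (hYT : Y ⊆ T) (hπ : ContDiffOn ℝ ∞ π T) :
    ∃ V : Eps → Fin m → SmoothFun n X, ∀ K : Set X, IsCompact K →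
      ∃ g : EuclideanSpace ℝ (Fin m) → EuclideanSpace ℝ (Fin m), ContDiff ℝ ∞ g ∧
      HasCompactSupport g ∧ ∃ D ⊆ T, IsCompact D ∧ EqOn g π D ∧
      ∃ K' : Set Y, Subtype.val '' K' ⊆ D ∧
        (IsNegligible fun ε ↦ ⨆ x ∈ K, Metric.infEDist (netValue U ε x) (complexSet K')) ∧
        ∀ᶠ ε in smallEps, ∀ x ∈ K, realVec (fun j ↦ (U j).1 ε) x ∈ D ∧
          ∀ j, V ε j =ᶠ[𝓝 x] complexCoord (fun x ↦ g (realVec (fun j ↦ (U j).1 ε) x)) j := by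
  have : LocallyCompactSpace X := ChartedSpace.locallyCompactSpace (EuclideanSpace ℝ (Fin n)) X
  let E := CompactExhaustion.choice X
  let w : Eps → X → EuclideanSpace ℝ (Fin m) := fun ε ↦ realVec fun j ↦ (U j).1 ε
  have hw : ∀ ε, ContMDiff (𝓡 n) (𝓡 m) ∞ (w ε) := fun ε ↦ contMDiff_realVec _
  have hπw : ∀ ε, ContMDiffOn (𝓡 n) (𝓡 m) ∞ (fun x ↦ π (w ε x)) (w ε ⁻¹' T) := fun ε ↦
    hπ.contMDiffOn.comp (hw ε).contMDiffOn fun x hx ↦ hx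
  -- The bound `⌈1 / ε⌉` tends to infinity, so every member of the exhaustion is eventually covered.
  choose f hf hfE using fun ε : Eps ↦ exists_contMDiff_eqOn_of_lt E
    (hT.preimage (hw ε).continuous) (hπw ε) ⌈(ε : ℝ)⁻¹⌉₊
  refine ⟨fun ε j ↦ ⟨complexCoord (f ε) j,
    (Complex.ofRealCLM.comp (EuclideanSpace.proj (𝕜 := ℝ) j)).contMDiff.comp (hf ε)⟩,
    fun K hK ↦ ?_⟩
  obtain ⟨l, hl⟩ := E.exists_superset_of_isCompact hK
  -- One step beyond `E l ⊇ K`: the closeness then holds on a neighborhood of each point of `K`,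
  -- which yields equality of germs.
  obtain ⟨K', hK', hU⟩ := isNegligiblyCloseTo_iff.1 h (E (l + 1)) (E.isCompact _)
  have hK'c := hK'.image continuous_subtype_val
  obtain ⟨δ, hδ, hthick⟩ := hK'c.exists_cthickening_subset_open hT
    ((image_subset_iff.2 fun y _ ↦ y.2).trans hYT)
  have hD := hK'c.cthickening (r := δ)
  obtain ⟨g, hg, hgc, hgπ⟩ := exists_contMDiff_eqOn_of_isCompact hD hT hthick hπ.contMDiffOn
  refine ⟨g, hg.contDiff, hgc, _, hthick, hD, hgπ, K', Metric.self_subset_cthickening _,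
    hU.mono fun ε ↦ biSup_mono fun x hx ↦ E.subset l.le_succ (hl hx), ?_⟩
  filter_upwards [hU.eventually_le, eventually_smallEps_lt hδ,
    eventually_mul_smallEps_lt_one ((l + 1 : ℕ) : ℝ)] with ε h1 h2 h3
  have hmem : ∀ x ∈ E (l + 1), w ε x ∈ Metric.cthickening δ (Subtype.val '' K') := by
    intro x hx
    rw [Metric.mem_cthickening_iff]
    refine le_trans ?_ (ENNReal.ofReal_le_ofReal h2.le)
    refine le_trans ?_ ((le_iSup₂ (f := fun x (_ : x ∈ E (l + 1)) ↦
      Metric.infEDist (netValue U ε x) (complexSet K')) x hx).trans h1)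
    refine le_iInf₂ fun _ ⟨y, hy, hyz⟩ ↦ ?_
    rw [← hyz]
    exact (Metric.infEDist_le_edist_of_mem (mem_image_of_mem _ hy)).trans (edist_realVec_le U ε x y)
  have hlt : l + 1 < ⌈(ε : ℝ)⁻¹⌉₊ := by
    rw [Nat.lt_ceil]
    rwa [← lt_div_iff₀ ε.2.1, one_div] at h3
  refine fun x hx ↦ ⟨hmem x (E.subset l.le_succ (hl hx)), fun j ↦ ?_⟩
  filter_upwards [isOpen_interior.mem_nhds (E.subset_interior_succ l (hl hx))] with z hz
  have hz' := interior_subset hz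
  have h4 : f ε z = π (w ε z) := hfE ε _ hlt (fun x hx ↦ hthick (hmem x hx)) hz'
  change ((f ε z j : ℝ) : ℂ) = ((g (w ε z) j : ℝ) : ℂ)
  rw [h4, hgπ (hmem z hz')]

/-- The new representative is, on each compact set and for small `ε`, the retraction applied to the
real part of the old one. -/
lemma IsNegligiblyCloseTo.isCBounded {n' : ℕ} [ChartedSpace (EuclideanSpace ℝ (Fin n')) Y]
    [IsManifold (𝓡 n') ∞ Y] (hY : IsEmbeddedSubmanifold n' Y) {U : Fin m → moderateNets n X}
    {u : Fin m → GenFun n X} (hU : IsRepresentative U u) (h : IsNegligiblyCloseTo U Y) :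
    IsCBounded u Y := by
  obtain ⟨π, T, hT, hYT, hπ, hπY, hπid⟩ := exists_contDiffOn_retraction hY
  obtain ⟨V, hV⟩ := h.exists_comp hT hYT hπ
  have hmod : ∀ j, (fun ε ↦ V ε j) ∈ moderateNets n X := by
    refine fun j ↦ mem_moderateNets fun K hK k ↦ ?_
    obtain ⟨g, hg, hgc, D, -, -, -, K', -, -, hVg⟩ := hV K hK
    choose b hb using fun j ↦ exists_isBigOPowOfOrder (U j) hK k
    obtain ⟨b₀, hb₀⟩ : ∃ b₀, ∀ j, b₀ ≤ b j := by
      obtain ⟨b₀, h₀⟩ := (finite_range b).bddBelow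
      exact ⟨b₀, fun j ↦ h₀ (mem_range_self j)⟩
    obtain ⟨b', hb'⟩ := exists_isBigOPowOfOrder_compRealVec (n := n) (m := m) K k b₀
    refine ⟨b', (hb' (fun j ↦ (U j).1) (fun j ↦ (hb j).weaken (hb₀ j)) _
      (contDiff_complexCoord hg j) (hasCompactSupport_complexCoord hgc j)).congr
      (eventually_smallEps_iff.1 ?_)⟩
    filter_upwards [hVg] with ε hε x hx
    exact (hε x hx).2 j
  let W : Fin m → moderateNets n X := fun j ↦ ⟨fun ε ↦ V ε j, hmod j⟩
  have hW : ∀ {ε x} {g : EuclideanSpace ℝ (Fin m) → EuclideanSpace ℝ (Fin m)},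
      (∀ j, V ε j =ᶠ[𝓝 x] complexCoord (fun x ↦ g (realVec (fun j ↦ (U j).1 ε) x)) j) →
      netValue W ε x = toComplex (g (realVec (fun j ↦ (U j).1 ε) x)) := by
    intro ε x g hg
    ext j
    exact (hg j).self_of_nhds
  refine ⟨W, hU.iff_isNegligible.2 fun K hK ↦ ?_, fun K hK ↦ ?_⟩
  · obtain ⟨g, hg, hgc, D, hDT, hD, hgπ, K', hK'D, hneg, hVg⟩ := hV K hK
    obtain ⟨C, hC⟩ := hg.lipschitzWith_of_hasCompactSupport hgc (by simp)
    refine (hneg.const_mul (C + 1)).of_eventually ?_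
    filter_upwards [hVg, hneg.eventually_le] with ε hε hle
    refine iSup₂_le fun x hx ↦ ?_
    refine le_trans ?_ (mul_le_mul' le_rfl (le_iSup₂ (f := fun x (_ : x ∈ K) ↦
      Metric.infEDist (netValue U ε x) (complexSet K')) x hx))
    -- Since `g` fixes `y ∈ K'`, the path through `y` costs `C` times the distance from `u_ε(x)` to
    -- `y` for the image under `g`, plus that distance once more.
    have hy : ∀ z ∈ complexSet K', edist (netValue W ε x) (netValue U ε x) ≤
        (C + 1 : ℝ≥0) * edist (netValue U ε x) z := by
      rintro _ ⟨y, hy, rfl⟩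
      have hgy : g y = y := (hgπ (hK'D (mem_image_of_mem _ hy))).trans (hπid y y.2)
      rw [hW (hε x hx).2]
      refine (edist_triangle_right _ _ (toComplex (y : EuclideanSpace ℝ (Fin m)))).trans ?_
      rw [isometry_toComplex.edist_eq]
      push_cast
      rw [add_mul, one_mul]
      refine add_le_add ?_ le_rfl
      nth_rewrite 1 [← hgy]
      exact (hC _ _).trans (mul_le_mul' le_rfl (edist_realVec_le U ε x y))
    -- The constant `C + 1` is nonzero and finite, so it moves inside the infimum, even if `K'` is
    -- empty.
    rw [Metric.infEDist, ENNReal.mul_iInf_of_ne (by simp) ENNReal.coe_ne_top]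
    refine le_iInf fun z ↦ ?_
    rw [ENNReal.mul_iInf_of_ne (by simp) ENNReal.coe_ne_top]
    exact le_iInf fun hz ↦ hy z hz
  · obtain ⟨g, hg, hgc, D, hDT, hD, hgπ, K', hK'D, hneg, hVg⟩ := hV K hK
    have hsub : g '' D ⊆ Y := by
      rintro _ ⟨z, hz, rfl⟩
      rw [hgπ hz]
      exact hπY (hDT hz)
    obtain ⟨e, he, hVg⟩ := eventually_smallEps_iff.1 hVg
    -- On `D ⊆ T` the map `g` is the retraction, so `g '' D` is a compact subset of `Y`. Halving `e`
    -- turns the strict bound on `ε` into the non-strict one required.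
    refine ⟨Subtype.val ⁻¹' (g '' D), ?_, e / 2, half_pos he, fun ε hε x hx ↦ ?_⟩
    · rw [Subtype.isCompact_iff, Subtype.image_preimage_coe, inter_eq_right.2 hsub]
      exact hD.image hg.continuous
    · obtain ⟨hxD, hxg⟩ := hVg ε (hε.trans_lt (half_lt_self he)) x hx
      rw [hW hxg]
      have hmem := mem_image_of_mem g hxD
      exact ⟨⟨_, hsub hmem⟩, hmem, rfl⟩

end Manifold

end Colombeau

/-! ### The equivalence of the characterizations -/

theorem mainTheorem6 {d₁ d₂ n₁ n₂ : ℕ}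
    (X : Set (EuclideanSpace ℝ (Fin d₁))) [ChartedSpace (EuclideanSpace ℝ (Fin n₁)) X]
    [IsManifold (𝓡 n₁) ∞ X] (hX : IsEmbeddedSubmanifold n₁ X)
    (Y : Set (EuclideanSpace ℝ (Fin d₂))) [ChartedSpace (EuclideanSpace ℝ (Fin n₂)) Y]
    [IsManifold (𝓡 n₂) ∞ Y] (hY : IsEmbeddedSubmanifold n₂ Y)
    (u : Fin d₂ → GenFun n₁ X) :
    List.TFAE
      [IsCBounded u Y,
        ∃ U : Fin d₂ → moderateNets n₁ X, IsRepresentative U u ∧ IsNegligiblyCloseTo U Y,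
        ∀ U : Fin d₂ → moderateNets n₁ X, IsRepresentative U u → IsNegligiblyCloseTo U Y,
        ∀ p : GenPoint n₁ X, ∃ q : GenPoint n₂ Y,
          (fun j ↦ pointValue hX (u j) p) = pointCoords hY q] := by
  have : LocallyCompactSpace Y := ChartedSpace.locallyCompactSpace (EuclideanSpace ℝ (Fin n₂)) Y
  tfae_have 1 → 2 := fun h ↦ h.exists_isNegligiblyCloseTo
  tfae_have 2 → 1 := fun ⟨_, hU, h⟩ ↦ h.isCBounded hY hU
  tfae_have 2 → 3 := fun ⟨_, hU, h⟩ _ hV ↦ h.congr hU hV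
  tfae_have 3 → 4 := fun h p ↦ by
    obtain ⟨U, hU⟩ := exists_isRepresentative u
    induction p using Quotient.inductionOn with
    | h p =>
      obtain ⟨q, hq⟩ := (h U hU).exists_compactNet p
      exact ⟨Quotient.mk _ q, (pointValue_eq_pointCoords_iff hX hY hU p q).2 hq⟩
  tfae_have 4 → 2 := fun h ↦ by
    obtain ⟨U, hU⟩ := exists_isRepresentative u
    refine ⟨U, hU, isNegligiblyCloseTo_of_forall_compactNet fun p ↦ ?_⟩
    obtain ⟨q, hq⟩ := h (Quotient.mk _ p)
    induction q using Quotient.inductionOn with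
    | h q => exact ⟨q, (pointValue_eq_pointCoords_iff hX hY hU p q).1 hq⟩
  tfae_finish
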